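/- Let $N\ge 2$ and let $\Gamma$ be the star graph consisting of $N$ half-lines $[0,\infty)$ glued at their common endpoint $0$. Functions on $\Gamma$ are families $u=(u_e)_{e=1}^N$ of complex-valued functions on $(0,\infty)$, with $\|u\|_p^p=\sum_{e=1}^N\int_0^\infty|u_e(x)|^p\,dx$ and $u'=(u_e')_{e=1}^N$. Let $H^1(\Gamma)$ be the space of all $u$ such that every $u_e$ is continuous on $[0,\infty)$ and lies in $H^1(0,\infty)$, and $u_1(0)=\dots=u_N(0)$; put $\|u\|_{H^1}^2=\|u\|_2^2+\|u'\|_2^2$. Let $X=H^1(\Gamma)\times H^1(\Gamma)$ with $\|(u,v)\|_X^2=\|u\|_{H^1}^2+\|v\|_{H^1}^2$. Let $a,b,c,\gamma,\omega$ be real numbers such that either (A1) $0<b<\min\{a,c\}$ or (A2) $a,c>0$ and $b>\max\{a,c\}$, and such that $\gamma>0$, $\omega>\gamma^2/N^2$ and $N\sqrt{\omega}-\gamma\le \frac{2\gamma}{N}$. Define $$E(u,v)=\|u'\|_2^2+\|v'\|_2^2-\gamma\left(|u_1(0)|^2+|v_1(0)|^2\right)-\tfrac12\left(a\|u\|_4^4+c\|v\|_4^4\right)-b\|uv\|_2^2,$$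 $$\alpha=\frac{2(b-c)}{b^2-ac}\left(N\sqrt{\omega}-\gamma\right),\qquad \beta=\frac{2(b-a)}{b^2-ac}\left(N\sqrt{\omega}-\gamma\right),$$ $$J(\alpha,\beta)=\inf\left\{E(u,v):\ (u,v)\in X,\ \|u\|_2^2=\alpha,\ \|v\|_2^2=\beta\right\},$$ $$\mathcal G(\alpha,\beta)=\left\{(u,v)\in X:\ E(u,v)=J(\alpha,\beta),\ \|u\|_2^2=\alpha,\ \|v\|_2^2=\beta\right\}.$$ A minimizing sequence is a sequence $(u_n,v_n)$ in $X$ with $\|u_n\|_2^2=\alpha$, $\|v_n\|_2^2=\beta$ for all $n$ and $E(u_n,v_n)\to J(\alpha,\beta)$. Then $J(\alpha,\beta)>-\infty$, and: (i) Every minimizing sequence is relatively compact in $X$: it has a subsequence that converges in the norm of $X$ to some $(\Phi_1,\Phi_2)\in X$. Moreover, $\mathcal G(\alpha,\beta)$ is non-empty. (ii) For every minimizing sequence $(u_n,v_n)$, $$\lim_{n\to\infty}\ \inf_{(\Phi_1,\Phi_2)\in\mathcal G(\alpha,\beta)}\left\|(u_n,v_n)-(\Phi_1,\Phi_2)\right\|_X=0.$$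 -/

import Mathlib

open Set Filter Topology MeasureTheory
open scoped NNReal

noncomputable section

namespace StarGraph

/-- `g` is a weak derivative of `f` on the open half-line `(0, ∞)`: integration by parts holds
against all smooth functions with compact support in `(0, ∞)`. -/
def IsWeakDeriv (f g : ℝ → ℂ) : Prop :=
  ∀ φ : ℝ → ℝ, ContDiff ℝ (⊤ : ℕ∞) φ → HasCompactSupport φ → tsupport φ ⊆ Ioi 0 →
    ∫ x in Ioi (0 : ℝ), ((deriv φ x : ℝ) : ℂ) * f x = - ∫ x in Ioi (0 : ℝ), (φ x : ℂ) * g x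

/-- `f ∈ H¹(ℝ⁺)`: both `f` and some weak derivative of `f` are square integrable on `(0, ∞)`. -/
def MemH1 (f : ℝ → ℂ) : Prop :=
  MemLp f 2 (volume.restrict (Ioi 0)) ∧
    ∃ g : ℝ → ℂ, MemLp g 2 (volume.restrict (Ioi 0)) ∧ IsWeakDeriv f g

open Classical in
/-- The square integrable weak derivative of `f` on `(0, ∞)`, which is unique almost everywhere
(and the zero function if there is none). -/
def weakDeriv (f : ℝ → ℂ) : ℝ → ℂ :=
  if h : ∃ g : ℝ → ℂ, MemLp g 2 (volume.restrict (Ioi 0)) ∧ IsWeakDeriv f g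
  then h.choose else 0

/-- A continuous function on an edge `[0, ∞)` read as a function of the real variable; only its
values on `[0, ∞)` matter. -/
def onLine (f : C(ℝ≥0, ℂ)) : ℝ → ℂ := fun x => f x.toNNReal

theorem integrable_mul_of_memLp {φ : ℝ → ℝ} (hφ : Continuous φ) (hc : HasCompactSupport φ)
    {f : ℝ → ℂ} (hf : MemLp f 2 (volume.restrict (Ioi 0))) :
    Integrable (fun x => (φ x : ℂ) * f x) (volume.restrict (Ioi (0 : ℝ))) := by
  have h1 : Continuous (fun x => (φ x : ℂ)) := by fun_prop
  have h2 : HasCompactSupport (fun x => (φ x : ℂ)) :=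
    hc.comp_left (g := fun t : ℝ => (t : ℂ)) (by simp)
  have h3 : MemLp (fun x => (φ x : ℂ)) 2 (volume.restrict (Ioi (0 : ℝ))) :=
    h1.memLp_of_hasCompactSupport h2
  exact h3.integrable_mul hf

theorem IsWeakDeriv.add {f₁ f₂ g₁ g₂ : ℝ → ℂ}
    (hf₁ : MemLp f₁ 2 (volume.restrict (Ioi 0))) (hf₂ : MemLp f₂ 2 (volume.restrict (Ioi 0)))
    (hg₁ : MemLp g₁ 2 (volume.restrict (Ioi 0))) (hg₂ : MemLp g₂ 2 (volume.restrict (Ioi 0)))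
    (h₁ : IsWeakDeriv f₁ g₁) (h₂ : IsWeakDeriv f₂ g₂) : IsWeakDeriv (f₁ + f₂) (g₁ + g₂) := by
  intro φ hφ hc hs
  have hd : Continuous (deriv φ) := hφ.continuous_deriv (by norm_cast)
  simp only [Pi.add_apply, mul_add]
  rw [integral_add (integrable_mul_of_memLp hd hc.deriv hf₁)
      (integrable_mul_of_memLp hd hc.deriv hf₂),
    integral_add (integrable_mul_of_memLp hφ.continuous hc hg₁)
      (integrable_mul_of_memLp hφ.continuous hc hg₂), h₁ φ hφ hc hs, h₂ φ hφ hc hs, neg_add]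

theorem IsWeakDeriv.const_smul {f g : ℝ → ℂ} (k : ℂ) (h : IsWeakDeriv f g) :
    IsWeakDeriv (k • f) (k • g) := by
  intro φ hφ hc hs
  simp only [Pi.smul_apply, smul_eq_mul, mul_left_comm _ k, integral_const_mul]
  rw [h φ hφ hc hs, mul_neg]

/-- The Sobolev space `H¹(Γ)` of the star graph `Γ` made of `N` half-lines `[0, ∞)` glued at `0`:
families of continuous functions on the edges that agree at the vertex and whose components
belong to `H¹(ℝ⁺)`. -/
def H1 (N : ℕ) : Submodule ℂ (Fin N → C(ℝ≥0, ℂ)) where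
  carrier := {u | (∀ e e' : Fin N, u e 0 = u e' 0) ∧ ∀ e : Fin N, MemH1 (onLine (u e))}
  add_mem' := by
    rintro u v ⟨hu, hu'⟩ ⟨hv, hv'⟩
    refine ⟨fun e e' => by simp [hu e e', hv e e'], fun e => ?_⟩
    obtain ⟨h1, g, hg, hd⟩ := hu' e
    obtain ⟨h2, k, hk, hd'⟩ := hv' e
    exact ⟨h1.add h2, g + k, hg.add hk, IsWeakDeriv.add h1 h2 hg hk hd hd'⟩
  zero_mem' := by
    refine ⟨fun e e' => rfl, fun e => ⟨MemLp.zero, 0, MemLp.zero, ?_⟩⟩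
    intro φ _ _ _
    simp [onLine]
  smul_mem' := by
    rintro k u ⟨hu, hu'⟩
    refine ⟨fun e e' => by simp [hu e e'], fun e => ?_⟩
    obtain ⟨h1, g, hg, hd⟩ := hu' e
    exact ⟨h1.const_smul k, k • g, hg.const_smul k, hd.const_smul k⟩

/-- The components of `u ∈ H¹(Γ)` as functions of the real variable `x ≥ 0`. -/
def comp {N : ℕ} (u : H1 N) : Fin N → ℝ → ℂ := fun e => onLine (u.1 e)

/-- The componentwise derivative `u'` of `u ∈ H¹(Γ)`. -/
def der {N : ℕ} (u : H1 N) : Fin N → ℝ → ℂ := fun e => weakDeriv (comp u e)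

/-- `‖f‖ₚᵖ`, the `p`-th power of the `Lᵖ(Γ)` norm, for a natural exponent `p`. -/
def normPow {N : ℕ} (p : ℕ) (f : Fin N → ℝ → ℂ) : ℝ :=
  ∑ e : Fin N, ∫ x in Ioi (0 : ℝ), ‖f e x‖ ^ p

/-- The mass `Q(u) = ‖u‖₂²`. -/
def mass {N : ℕ} (u : H1 N) : ℝ := normPow 2 (comp u)

/-- The energy space `X = H¹(Γ) × H¹(Γ)`. Convergence in `X` is always meant, and written, with
respect to `normX` below. -/
abbrev X (N : ℕ) := H1 N × H1 N

/-- The norm of `X`: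
`‖(u, v)‖_X² = ‖u‖²_{H¹} + ‖v‖²_{H¹}` with `‖u‖²_{H¹} = ‖u‖₂² + ‖u'‖₂²`. -/
def normX {N : ℕ} (w : X N) : ℝ :=
  √((normPow 2 (comp w.1) + normPow 2 (der w.1)) + (normPow 2 (comp w.2) + normPow 2 (der w.2)))

/-- The energy
`E(u,v) = ‖u'‖₂² + ‖v'‖₂² - γ(|u₁(0)|² + |v₁(0)|²) - (a‖u‖₄⁴ + c‖v‖₄⁴)/2 - b‖uv‖₂²`. -/
def energy {N : ℕ} [NeZero N] (a b c γ : ℝ) (w : X N) : ℝ :=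
  normPow 2 (der w.1) + normPow 2 (der w.2)
    - γ * (‖comp w.1 0 0‖ ^ 2 + ‖comp w.2 0 0‖ ^ 2)
    - 1 / 2 * (a * normPow 4 (comp w.1) + c * normPow 4 (comp w.2))
    - b * normPow 2 (fun e x => comp w.1 e x * comp w.2 e x)

/-- The pairs with prescribed masses `‖u‖₂² = α`, `‖v‖₂² = β`. -/
def constraint (N : ℕ) (α β : ℝ) : Set (X N) := {w | mass w.1 = α ∧ mass w.2 = β}

/-- `J(α,β)`, the infimum of the energy under the mass constraints. -/
def J (N : ℕ) [NeZero N] (a b c γ α β : ℝ) : ℝ :=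
  sInf (energy a b c γ '' constraint N α β)

/-- A minimizing sequence for `J(α,β)`. -/
def IsMinimizingSeq {N : ℕ} [NeZero N] (a b c γ α β : ℝ) (w : ℕ → X N) : Prop :=
  (∀ n, w n ∈ constraint N α β) ∧
    Tendsto (fun n => energy a b c γ (w n)) atTop (𝓝 (J N a b c γ α β))

/-- `𝒢(α,β)`, the set of minimizers. -/
def minimizers (N : ℕ) [NeZero N] (a b c γ α β : ℝ) : Set (X N) :=
  {w | J N a b c γ α β = energy a b c γ w ∧ w ∈ constraint N α β}

/-- The first mass `α(ω)`. -/
def massA (N : ℕ) (a b c γ ω : ℝ) : ℝ := 2 * (b - c) / (b ^ 2 - a * c) * (N * √ω - γ)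

/-- The second mass `β(ω)`. -/
def massB (N : ℕ) (a b c γ ω : ℝ) : ℝ := 2 * (b - a) / (b ^ 2 - a * c) * (N * √ω - γ)

end StarGraph

end

noncomputable section

namespace StarGraph

/-! The coefficients ρ = (b - c)/(b² - ac) and σ = (b - a)/(b² - ac) solve aρ + bσ = bρ + cσ = 1,
and either sign condition makes both positive. Substituting (√ρ u, √σ v) decouples the system
(`energy_scaledPair`): the energy becomes ρ E₁(u) + σ E₁(v) + (bρσ/2) ∫ (|u|² - |v|²)², where E₁ is
the scalar energy with cubic coefficient one. Both components then have the same mass m = 2(N√ω -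
γ). Since pairs (u, u) kill the last term, J = (ρ + σ) J₁(m) with J₁ the scalar infimum. Along a
minimizing sequence each component therefore minimizes E₁ and the last integral tends to 0, so
everything reduces to compactness for E₁ at mass m.

The hypothesis on ω says exactly that m > 0 and Nm ≤ 4γ. A mass-m multiple of exp(-γx/N), the bound
state of the linear vertex interaction, then has E₁ < -m³/16 (`exists_scalarEnergy_lt`). Conversely,
a function of mass μ that is small at the vertex has energy at least about -μ³/16
(`scalarEnergy_ge_vertex`), so escaping from the vertex is too expensive.

To use this, extract a weak limit φ of a scalar minimizing sequence. Mass, kinetic energy and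
quartic term split between φ and a remainder vanishing at the vertex (`exists_weak_limit`), so J₁(m)
- E₁(φ) ≥ -(m - mass φ)³/16. Together with mass φ · J₁(m) ≤ m E₁(φ) (`mul_scalarJ_le`), a loss of
mass would force J₁(m) ≥ -m³/16, a contradiction. This excludes vanishing and dichotomy at once. The
remainder thus loses all its mass, and then its kinetic energy too. -/

/-! ### Weak derivatives on the half-line and the fundamental theorem of calculus -/

theorem weakDeriv_memLp {f : ℝ → ℂ} (hf : MemH1 f) :
    MemLp (weakDeriv f) 2 (volume.restrict (Ioi 0)) := by
  rw [weakDeriv, dif_pos hf.2]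
  exact hf.2.choose_spec.1

theorem weakDeriv_isWeakDeriv {f : ℝ → ℂ} (hf : MemH1 f) : IsWeakDeriv f (weakDeriv f) := by
  rw [weakDeriv, dif_pos hf.2]
  exact hf.2.choose_spec.2

theorem continuous_onLine (h : C(ℝ≥0, ℂ)) : Continuous (onLine h) :=
  h.continuous.comp continuous_real_toNNReal

/-- Square integrable weak derivatives are unique almost everywhere. -/
theorem IsWeakDeriv.ae_eq {f g g' : ℝ → ℂ} (hg : MemLp g 2 (volume.restrict (Ioi 0)))
    (hg' : MemLp g' 2 (volume.restrict (Ioi 0))) (h : IsWeakDeriv f g) (h' : IsWeakDeriv f g') :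
    g =ᵐ[volume.restrict (Ioi 0)] g' := by
  have hloc : LocallyIntegrable (fun x => g x - g' x) (volume.restrict (Ioi (0 : ℝ))) :=
    (hg.sub hg').locallyIntegrable (by norm_num)
  have := isOpen_Ioi.ae_eq_zero_of_integral_contDiff_smul_eq_zero (U := Ioi (0 : ℝ))
    (hloc.locallyIntegrableOn _) (fun φ hφ hc hs => by
      have h1 := integrable_mul_of_memLp hφ.continuous hc hg
      have h2 := integrable_mul_of_memLp hφ.continuous hc hg'
      simp only [Complex.real_smul, mul_sub]
      rw [integral_sub h1 h2, sub_eq_zero]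
      have e1 := h φ hφ hc hs
      have e2 := h' φ hφ hc hs
      exact neg_injective (e1.symm.trans e2))
  filter_upwards [this, ae_restrict_mem measurableSet_Ioi] with x hx hx0
  exact sub_eq_zero.1 (hx hx0)

theorem deriv_smoothTransition_eq_zero {s : ℝ} (hs : s < 0 ∨ 1 < s) :
    deriv Real.smoothTransition s = 0 := by
  rcases hs with hs | hs
  · have : Real.smoothTransition =ᶠ[𝓝 s] fun _ => 0 := by
      filter_upwards [gt_mem_nhds hs] with t ht
      exact Real.smoothTransition.zero_of_nonpos ht.le
    rw [this.deriv_eq, deriv_const]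
  · have : Real.smoothTransition =ᶠ[𝓝 s] fun _ => 1 := by
      filter_upwards [lt_mem_nhds hs] with t ht
      exact Real.smoothTransition.one_of_one_le ht.le
    rw [this.deriv_eq, deriv_const]

theorem continuous_deriv_smoothTransition : Continuous (deriv Real.smoothTransition) :=
  (Real.smoothTransition.contDiff (n := 1)).continuous_deriv le_rfl

/-- Substitute s = (t - x)/ε - 1. The derivative of the transition lives on [0, 1], so the integrand
lives on [x + ε, x + 2ε], and the restriction to the half-line is harmless. -/
theorem integral_deriv_smoothTransition_rescaled {f : ℝ → ℂ} {x ε : ℝ} (hx : 0 ≤ x)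
    (hε : 0 < ε) :
    ∫ t in Ioi (0 : ℝ), ((ε⁻¹ * deriv Real.smoothTransition ((t - x) / ε - 1) : ℝ) : ℂ) * f t =
      ∫ s in (0 : ℝ)..1, ((deriv Real.smoothTransition s : ℝ) : ℂ) * f (x + ε * (s + 1)) := by
  rw [setIntegral_eq_integral_of_forall_compl_eq_zero]
  · set h : ℝ → ℂ := fun s =>
      ((ε⁻¹ * deriv Real.smoothTransition s : ℝ) : ℂ) * f (x + ε * (s + 1)) with hh
    have e1 : (fun t : ℝ =>
        ((ε⁻¹ * deriv Real.smoothTransition ((t - x) / ε - 1) : ℝ) : ℂ) * f t) =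
        fun t => h ((t - x) / ε - 1) := by
      funext t
      simp only [hh]
      congr 2
      field_simp
      ring
    rw [e1, integral_sub_right_eq_self (fun t => h (t / ε - 1)) x,
      Measure.integral_comp_div (fun t => h (t - 1)) ε, integral_sub_right_eq_self h 1,
      intervalIntegral.integral_of_le zero_le_one, ← integral_Icc_eq_integral_Ioc,
      setIntegral_eq_integral_of_forall_compl_eq_zero, abs_of_pos hε, ← integral_smul]
    · congr 1
      funext s
      simp only [hh, Complex.real_smul]
      push_cast
      have : (ε : ℂ) ≠ 0 := by exact_mod_cast hε.ne'
      field_simp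
    · intro s hs
      have : s < 0 ∨ 1 < s := by
        by_contra hcon
        push Not at hcon
        exact hs ⟨hcon.1, hcon.2⟩
      simp [deriv_smoothTransition_eq_zero this]
  · intro t ht
    have : (t - x) / ε - 1 < 0 := by
      have : (t - x) / ε ≤ 0 := div_nonpos_of_nonpos_of_nonneg (by
        have := notMem_Ioi.1 ht
        linarith) hε.le
      linarith
    simp [deriv_smoothTransition_eq_zero (Or.inl this)]

/-- These are weighted averages of `f` just to the right of `x`: the weight has total integral 1,
and the integral is continuous in ε. -/
theorem tendsto_integral_deriv_smoothTransition {f : ℝ → ℂ} (hf : Continuous f) (x : ℝ) :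
    Tendsto (fun ε : ℝ => ∫ s in (0 : ℝ)..1,
      ((deriv Real.smoothTransition s : ℝ) : ℂ) * f (x + ε * (s + 1))) (𝓝 0) (𝓝 (f x)) := by
  have hS := continuous_deriv_smoothTransition
  have hc : Continuous (fun ε : ℝ => ∫ s in (0 : ℝ)..1,
      ((deriv Real.smoothTransition s : ℝ) : ℂ) * f (x + ε * (s + 1))) := by
    apply intervalIntegral.continuous_parametric_intervalIntegral_of_continuous'
    fun_prop
  have h0 := hc.tendsto 0
  simp only [zero_mul, add_zero] at h0
  rw [intervalIntegral.integral_mul_const, intervalIntegral.integral_ofReal,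
    intervalIntegral.integral_deriv_eq_sub
      (fun s _ => (Real.smoothTransition.contDiff (n := 1)).differentiable (by norm_num) s)
      (hS.intervalIntegrable _ _)] at h0
  simpa using h0

theorem integrableOn_Ioc_of_memLp {g : ℝ → ℂ} (hg : MemLp g 2 (volume.restrict (Ioi 0)))
    (R : ℝ) : IntegrableOn g (Ioc 0 R) :=
  (hg.mono_measure (Measure.restrict_mono Ioc_subset_Ioi_self le_rfl)).integrable one_le_two

theorem intervalIntegrable_of_memLp {g : ℝ → ℂ} (hg : MemLp g 2 (volume.restrict (Ioi 0)))
    {x y : ℝ} (hx : 0 ≤ x) (hy : 0 ≤ y) : IntervalIntegrable g volume x y := by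
  rw [intervalIntegrable_iff]
  exact (integrableOn_Ioc_of_memLp hg (max x y)).mono_set
    (Ioc_subset_Ioc_left (le_min hx hy))

/-- Test the weak derivative against a smoothed indicator of (x, y]. One side becomes averages of
`f` near `x` and `y`, the other converges to the integral of `g`. -/
theorem IsWeakDeriv.sub_eq_integral {f g : ℝ → ℂ} (hf : Continuous f)
    (hg : MemLp g 2 (volume.restrict (Ioi 0))) (h : IsWeakDeriv f g) {x y : ℝ} (hx : 0 ≤ x)
    (hxy : x ≤ y) : f y - f x = ∫ t in x..y, g t := by
  set S := Real.smoothTransition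
  have hSc : ContDiff ℝ (⊤ : ℕ∞) S := Real.smoothTransition.contDiff
  -- The shift by -1 pushes the support into [x + ε, y + 2ε], which stays inside (0, ∞) even when x
  -- = 0.
  let φ : ℝ → ℝ → ℝ := fun ε t => S ((t - x) / ε - 1) - S ((t - y) / ε - 1)
  have hφ : ∀ ε, ContDiff ℝ (⊤ : ℕ∞) (φ ε) := fun ε => by
    apply ContDiff.sub
    · exact hSc.comp (((contDiff_id.sub contDiff_const).div_const ε).sub contDiff_const)
    · exact hSc.comp (((contDiff_id.sub contDiff_const).div_const ε).sub contDiff_const)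
  have hsupp : ∀ ε, 0 < ε → ∀ t, t ∉ Icc (x + ε) (y + 2 * ε) → φ ε t = 0 := by
    intro ε hε t ht
    rw [mem_Icc, not_and_or, not_le, not_le] at ht
    rcases ht with ht | ht
    · have h1 : (t - x) / ε - 1 ≤ 0 := by
        rw [sub_nonpos, div_le_one hε]; linarith
      have h2 : (t - y) / ε - 1 ≤ 0 := by
        rw [sub_nonpos, div_le_one hε]; linarith
      simp only [φ, S, Real.smoothTransition.zero_of_nonpos h1,
        Real.smoothTransition.zero_of_nonpos h2, sub_zero]
    · have h1 : 1 ≤ (t - x) / ε - 1 := by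
        rw [le_sub_iff_add_le, le_div_iff₀ hε]; linarith
      have h2 : 1 ≤ (t - y) / ε - 1 := by
        rw [le_sub_iff_add_le, le_div_iff₀ hε]; linarith
      simp only [φ, S, Real.smoothTransition.one_of_one_le h1,
        Real.smoothTransition.one_of_one_le h2, sub_self]
  have hts : ∀ ε, 0 < ε → tsupport (φ ε) ⊆ Icc (x + ε) (y + 2 * ε) := fun ε hε =>
    closure_minimal (fun t ht => by
      by_contra hcon
      exact ht (hsupp ε hε t hcon)) isClosed_Icc
  have hcs : ∀ ε, 0 < ε → HasCompactSupport (φ ε) := fun ε hε =>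
    isCompact_Icc.of_isClosed_subset (isClosed_tsupport _) (hts ε hε)
  have hder : ∀ ε t, deriv (φ ε) t =
      ε⁻¹ * deriv S ((t - x) / ε - 1) - ε⁻¹ * deriv S ((t - y) / ε - 1) := by
    intro ε t
    have hd : ∀ z, HasDerivAt (fun t : ℝ => S ((t - z) / ε - 1))
        (ε⁻¹ * deriv S ((t - z) / ε - 1)) t := by
      intro z
      have h1 : HasDerivAt (fun t : ℝ => (t - z) / ε - 1) (1 / ε) t :=
        (((hasDerivAt_id t).sub_const z).div_const ε).sub_const 1
      have h2 := ((hSc.differentiable (by simp)) ((t - z) / ε - 1)).hasDerivAt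
      have h3 := h2.comp t h1
      rw [one_div, mul_comm] at h3
      exact h3
    exact ((hd x).sub (hd y)).deriv
  have key : ∀ ε, 0 < ε →
      (∫ s in (0 : ℝ)..1, ((deriv S s : ℝ) : ℂ) * f (x + ε * (s + 1))) -
      (∫ s in (0 : ℝ)..1, ((deriv S s : ℝ) : ℂ) * f (y + ε * (s + 1))) =
      - ∫ t in Ioi (0 : ℝ), (φ ε t : ℂ) * g t := by
    intro ε hε
    rw [← h (φ ε) (hφ ε) (hcs ε hε) ((hts ε hε).trans fun t ht => by
      have := ht.1
      simp only [mem_Ioi]; linarith)]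
    rw [← integral_deriv_smoothTransition_rescaled hx hε,
      ← integral_deriv_smoothTransition_rescaled (hx.trans hxy) hε, ← integral_sub]
    · congr 1
      funext t
      rw [hder]
      push_cast
      ring
    all_goals
      apply Integrable.integrableOn
      apply Continuous.integrable_of_hasCompactSupport
      · have := continuous_deriv_smoothTransition
        fun_prop
      · refine HasCompactSupport.of_support_subset_isCompact
          (isCompact_Icc (a := x) (b := y + 2 * ε)) fun t ht => ?_
        by_contra hcon
        refine ht ?_
        rw [mem_Icc, not_and_or, not_le, not_le] at hcon
        beta_reduce
        rw [deriv_smoothTransition_eq_zero]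
        · simp
        · rcases hcon with hcon | hcon
          · left
            rw [sub_neg, div_lt_one hε]
            linarith
          · right
            rw [lt_sub_iff_add_lt, lt_div_iff₀ hε]
            linarith
  have hlim1 := ((tendsto_integral_deriv_smoothTransition hf x).sub
    (tendsto_integral_deriv_smoothTransition hf y)).comp
    (tendsto_one_div_add_atTop_nhds_zero_nat (𝕜 := ℝ))
  have hgint : IntegrableOn g (Ioc 0 (y + 2)) := integrableOn_Ioc_of_memLp hg (y + 2)
  have hlim2 : Tendsto (fun n : ℕ => ∫ t in Ioi (0 : ℝ), (φ (1 / ((n : ℝ) + 1)) t : ℂ) * g t) atTop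
      (𝓝 (∫ t in Ioi (0 : ℝ), (Ioc x y).indicator g t)) := by
    apply tendsto_integral_of_dominated_convergence
      ((Ioc 0 (y + 2)).indicator (fun t => ‖g t‖))
    · intro n
      exact ((Complex.continuous_ofReal.comp (hφ _).continuous).aestronglyMeasurable).mul hg.1
    · exact ((integrable_indicator_iff measurableSet_Ioc).2 hgint.norm).restrict
    · intro n
      filter_upwards [ae_restrict_mem measurableSet_Ioi] with t ht
      have hn : (0 : ℝ) < 1 / ((n : ℝ) + 1) := by positivity
      have hn1 : 1 / ((n : ℝ) + 1) ≤ 1 := by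
        rw [div_le_one (by positivity)]; linarith [(Nat.cast_nonneg n : (0 : ℝ) ≤ n)]
      by_cases hmem : t ∈ Ioc 0 (y + 2)
      · rw [indicator_of_mem hmem, norm_mul]
        refine mul_le_of_le_one_left (norm_nonneg _) ?_
        rw [Complex.norm_real, Real.norm_eq_abs, abs_le]
        have a1 := Real.smoothTransition.le_one ((t - x) / (1 / ((n : ℝ) + 1)) - 1)
        have a2 := Real.smoothTransition.le_one ((t - y) / (1 / ((n : ℝ) + 1)) - 1)
        have a3 := Real.smoothTransition.nonneg ((t - x) / (1 / ((n : ℝ) + 1)) - 1)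
        have a4 := Real.smoothTransition.nonneg ((t - y) / (1 / ((n : ℝ) + 1)) - 1)
        constructor <;> simp only [φ, S] <;> linarith
      · rw [indicator_of_notMem hmem, hsupp _ hn t]
        · simp
        · intro hcon
          exact hmem ⟨ht, hcon.2.trans (by linarith)⟩
    · filter_upwards with t
      have hlim : ∀ z, Tendsto (fun n : ℕ => S ((t - z) / (1 / ((n : ℝ) + 1)) - 1)) atTop
          (𝓝 (if z < t then 1 else 0)) := by
        intro z
        split_ifs with hz
        · apply tendsto_const_nhds.congr'
          have : Tendsto (fun n : ℕ => (t - z) * ((n : ℝ) + 1)) atTop atTop :=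
            (tendsto_natCast_atTop_atTop.atTop_add tendsto_const_nhds).const_mul_atTop
              (sub_pos.2 hz)
          filter_upwards [this.eventually_ge_atTop 2] with n hn
          refine (Real.smoothTransition.one_of_one_le ?_).symm
          rw [div_div_eq_mul_div, div_one]
          linarith
        · apply tendsto_const_nhds.congr
          intro n
          refine (Real.smoothTransition.zero_of_nonpos ?_).symm
          have : (t - z) / (1 / ((n : ℝ) + 1)) ≤ 0 :=
            div_nonpos_of_nonpos_of_nonneg (by linarith) (by positivity)
          linarith
      have h1 := (hlim x).sub (hlim y)
      have h2 : Tendsto (fun n : ℕ => (φ (1 / ((n : ℝ) + 1)) t : ℂ) * g t) atTop _ :=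
        ((Complex.continuous_ofReal.tendsto _).comp h1).mul_const (g t)
      convert h2 using 2
      by_cases ht : x < t <;> by_cases ht' : y < t
      · simp [indicator, ht, ht', not_le.2 ht']
      · simp [indicator, ht, ht', not_lt.1 ht']
      · exact absurd (hxy.trans_lt ht') ht
      · simp [indicator, ht, ht']
  have hfin := tendsto_nhds_unique (hlim1.congr fun n => key _ (by positivity)) hlim2.neg
  rw [setIntegral_indicator measurableSet_Ioc, inter_eq_right.2 (fun t ht => mem_Ioi.2 (hx.trans_lt ht.1)),
    ← intervalIntegral.integral_of_le hxy] at hfin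
  rw [← neg_sub, hfin, neg_neg]

/-! ### Pointwise bounds by the L² norms of a function and its derivative -/

theorem integral_mul_eq_sq_sub_sq {p q : ℝ → ℝ} {x y : ℝ} (hxy : x ≤ y)
    (hq : IntervalIntegrable q volume x y)
    (h : ∀ t ∈ Icc x y, p t = p x + ∫ s in x..t, q s) :
    2 * ∫ t in x..y, p t * q t = p y ^ 2 - p x ^ 2 := by
  -- `p` is a primitive only on [x, y]; `P` is one everywhere, hence absolutely continuous, and the
  -- product rule applies to P · P.
  set P : ℝ → ℝ := fun t => p x + ∫ s in x..t, q s with hP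
  have hac : AbsolutelyContinuousOnInterval P x y := by
    have h1 : AbsolutelyContinuousOnInterval (fun _ : ℝ => p x) x y :=
      (contDiff_const (n := 1)).contDiffOn.absolutelyContinuousOnInterval
    exact h1.add (hq.absolutelyContinuousOnInterval_intervalIntegral left_mem_uIcc)
  have hint := hac.integral_deriv_mul_eq_sub hac
  rw [h y (right_mem_Icc.2 hxy)]
  have hx0 : P x = p x := by simp [hP]
  rw [hx0] at hint
  rw [sq, sq, ← hint, ← intervalIntegral.integral_const_mul]
  apply intervalIntegral.integral_congr_ae
  filter_upwards [hq.ae_hasDerivAt_integral] with t ht hmem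
  have hd := ((ht (uIoc_subset_uIcc hmem) x left_mem_uIcc).const_add (p x)).deriv
  rw [uIoc_of_le hxy] at hmem
  rw [h t (Ioc_subset_Icc_self hmem), hd]
  ring

/-- The derivative of |f|² is twice the real part of conj(f) g, obtained from the real and imaginary
parts separately. -/
theorem abs_norm_sq_sub_norm_sq_le {f g : ℝ → ℂ} {x y : ℝ} (hxy : x ≤ y)
    (hf : Continuous f) (hg : IntervalIntegrable g volume x y)
    (h : ∀ t ∈ Icc x y, f t = f x + ∫ s in x..t, g s) :
    |‖f y‖ ^ 2 - ‖f x‖ ^ 2| ≤ 2 * ∫ t in x..y, ‖f t‖ * ‖g t‖ := by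
  have hsub : ∀ t ∈ Icc x y, IntervalIntegrable g volume x t := fun t ht =>
    hg.mono_set (uIcc_subset_uIcc_left (by rwa [uIcc_of_le hxy]))
  have hre : IntervalIntegrable (fun t => (g t).re) volume x y :=
    ⟨hg.1.re, hg.2.re⟩
  have him : IntervalIntegrable (fun t => (g t).im) volume x y :=
    ⟨hg.1.im, hg.2.im⟩
  have h1 := integral_mul_eq_sq_sub_sq (p := fun t => (f t).re) hxy hre (fun t ht => by
    rw [h t ht, Complex.add_re]
    congr 1
    exact (Complex.reCLM.intervalIntegral_comp_comm (hsub t ht)).symm)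
  have h2 := integral_mul_eq_sq_sub_sq (p := fun t => (f t).im) hxy him (fun t ht => by
    rw [h t ht, Complex.add_im]
    congr 1
    exact (Complex.imCLM.intervalIntegral_comp_comm (hsub t ht)).symm)
  have e : ‖f y‖ ^ 2 - ‖f x‖ ^ 2 =
      2 * ∫ t in x..y, ((f t).re * (g t).re + (f t).im * (g t).im) := by
    rw [intervalIntegral.integral_add (hre.continuousOn_mul (by fun_prop))
      (him.continuousOn_mul (by fun_prop)), mul_add, h1, h2, Complex.sq_norm, Complex.sq_norm,
      Complex.normSq_apply, Complex.normSq_apply]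
    ring
  rw [e, abs_mul, abs_two]
  refine mul_le_mul_of_nonneg_left ?_ zero_le_two
  refine (intervalIntegral.abs_integral_le_integral_abs hxy).trans ?_
  refine intervalIntegral.integral_mono_on hxy ?_ ?_ fun t _ => ?_
  · exact ((hre.continuousOn_mul (by fun_prop)).add (him.continuousOn_mul (by fun_prop))).abs
  · exact hg.norm.continuousOn_mul (by fun_prop)
  · rw [← Complex.norm_conj (f t), ← norm_mul]
    refine le_trans (le_of_eq ?_) (Complex.abs_re_le_norm _)
    simp

/-- Cauchy-Schwarz for square integrable functions. -/
theorem integral_norm_mul_norm_le {α : Type*} [MeasurableSpace α] {ν : Measure α} {f g : α → ℂ}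
    (hf : MemLp f 2 ν) (hg : MemLp g 2 ν) :
    ∫ t, ‖f t‖ * ‖g t‖ ∂ν ≤ √(∫ t, ‖f t‖ ^ 2 ∂ν) * √(∫ t, ‖g t‖ ^ 2 ∂ν) := by
  have := integral_mul_norm_le_Lp_mul_Lq (μ := ν) (f := f) (g := g) Real.HolderConjugate.two_two
    (by simpa using hf) (by simpa using hg)
  simpa [Real.sqrt_eq_rpow] using this

theorem integrable_norm_mul_norm {α : Type*} [MeasurableSpace α] {ν : Measure α} {f g : α → ℂ}
    (hf : MemLp f 2 ν) (hg : MemLp g 2 ν) : Integrable (fun t => ‖f t‖ * ‖g t‖) ν :=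
  hf.norm.integrable_mul hg.norm

theorem integrable_norm_sq {α : Type*} [MeasurableSpace α] {ν : Measure α} {f : α → ℂ}
    (hf : MemLp f 2 ν) : Integrable (fun t => ‖f t‖ ^ 2) ν :=
  (memLp_two_iff_integrable_sq_norm hf.1).1 hf

/-- Otherwise a positive constant would be integrable on a half-line. This weak form of decay at
infinity is all that the pointwise bounds need. -/
theorem exists_norm_sq_lt_of_memLp {f : ℝ → ℂ} (hf : MemLp f 2 (volume.restrict (Ioi 0)))
    (x : ℝ) {ε : ℝ} (hε : 0 < ε) : ∃ y, x ≤ y ∧ ‖f y‖ ^ 2 < ε := by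
  by_contra hcon
  push Not at hcon
  have hint : IntegrableOn (fun t => ‖f t‖ ^ 2) (Ioi (max x 0)) :=
    (integrable_norm_sq hf).mono_measure
      (Measure.restrict_mono (Ioi_subset_Ioi (le_max_right _ _)) le_rfl)
  have hc : IntegrableOn (fun _ : ℝ => ε) (Ioi (max x 0)) := by
    refine hint.mono' aestronglyMeasurable_const ?_
    filter_upwards [ae_restrict_mem measurableSet_Ioi] with t ht
    rw [Real.norm_of_nonneg hε.le]
    exact hcon t ((le_max_left _ _).trans (le_of_lt ht))
  rw [integrableOn_const_iff] at hc
  simp [hε.ne'] at hc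

/-- Compare |f(x)|² with its value at 0 and with a tiny value far to the right. The two intervals
are disjoint, so together they use the integral only once. Keeping |f(0)|² separate yields a better
constant when the vertex value is small. -/
theorem two_mul_norm_sq_le {f g : ℝ → ℂ} (hf : Continuous f)
    (hf2 : MemLp f 2 (volume.restrict (Ioi 0))) (hg : MemLp g 2 (volume.restrict (Ioi 0)))
    (h : IsWeakDeriv f g) {x : ℝ} (hx : 0 ≤ x) :
    2 * ‖f x‖ ^ 2 ≤ ‖f 0‖ ^ 2 + 2 * ∫ t in Ioi (0 : ℝ), ‖f t‖ * ‖g t‖ := by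
  refine le_of_forall_pos_le_add fun ε hε => ?_
  obtain ⟨y, hxy, hy⟩ := exists_norm_sq_lt_of_memLp hf2 x hε
  have hint := integrable_norm_mul_norm hf2 hg
  have hloc : ∀ {u v : ℝ}, 0 ≤ u → u ≤ v →
      |‖f v‖ ^ 2 - ‖f u‖ ^ 2| ≤ 2 * ∫ t in Ioc u v, ‖f t‖ * ‖g t‖ := by
    intro u v hu huv
    rw [← intervalIntegral.integral_of_le huv]
    refine abs_norm_sq_sub_norm_sq_le huv hf
      (intervalIntegrable_of_memLp hg hu (hu.trans huv)) fun t ht => ?_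
    rw [← h.sub_eq_integral hf hg hu ht.1]
    ring
  have h1 := (abs_le.1 (hloc le_rfl hx)).2
  have h2 := (abs_le.1 (hloc hx hxy)).1
  have h3 : ∫ t in Ioc 0 y, ‖f t‖ * ‖g t‖ =
      (∫ t in Ioc 0 x, ‖f t‖ * ‖g t‖) + ∫ t in Ioc x y, ‖f t‖ * ‖g t‖ := by
    rw [← Ioc_union_Ioc_eq_Ioc hx hxy, setIntegral_union
      (Ioc_disjoint_Ioc_of_le le_rfl) measurableSet_Ioc
      (hint.mono_measure (Measure.restrict_mono Ioc_subset_Ioi_self le_rfl))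
      (hint.mono_measure (Measure.restrict_mono
        (fun t ht => mem_Ioi.2 (hx.trans_lt ht.1)) le_rfl))]
  have h4 : ∫ t in Ioc 0 y, ‖f t‖ * ‖g t‖ ≤ ∫ t in Ioi (0 : ℝ), ‖f t‖ * ‖g t‖ :=
    setIntegral_mono_set hint (Eventually.of_forall fun t => by positivity)
      (Ioc_subset_Ioi_self).eventuallyLE
  linarith

theorem norm_sq_le_two_mul {f g : ℝ → ℂ} (hf : Continuous f)
    (hf2 : MemLp f 2 (volume.restrict (Ioi 0))) (hg : MemLp g 2 (volume.restrict (Ioi 0)))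
    (h : IsWeakDeriv f g) {x : ℝ} (hx : 0 ≤ x) :
    ‖f x‖ ^ 2 ≤ 2 * ∫ t in Ioi (0 : ℝ), ‖f t‖ * ‖g t‖ := by
  have h0 := two_mul_norm_sq_le hf hf2 hg h le_rfl
  have h1 := two_mul_norm_sq_le hf hf2 hg h hx
  linarith

/-! ### Weak compactness in L² and H¹ of the half-line -/

/-- Bounded sequences of square integrable functions have weakly convergent subsequences. -/
theorem exists_weak_subseq {F : ℕ → ℝ → ℂ} {C : ℝ}
    (hF : ∀ n, MemLp (F n) 2 (volume.restrict (Ioi 0)))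
    (hC : ∀ n, ∫ t in Ioi (0 : ℝ), ‖F n t‖ ^ 2 ≤ C) :
    ∃ g : ℝ → ℂ, MemLp g 2 (volume.restrict (Ioi 0)) ∧ ∃ k : ℕ → ℕ, StrictMono k ∧
      ∀ ψ : ℝ → ℂ, MemLp ψ 2 (volume.restrict (Ioi 0)) →
        Tendsto (fun j => ∫ t in Ioi (0 : ℝ), ψ t * F (k j) t) atTop
          (𝓝 (∫ t in Ioi (0 : ℝ), ψ t * g t)) := by
  set ν : Measure ℝ := volume.restrict (Ioi 0) with hν
  let E := Lp ℂ 2 ν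
  have : Fact ((2 : ENNReal) ≠ ⊤) := ⟨by norm_num⟩
  have hsc : SecondCountableTopology E := inferInstance
  have hinner : ∀ {a b : ℝ → ℂ} (ha : MemLp a 2 ν) (hb : MemLp b 2 ν),
      inner ℂ (ha.toLp a) (hb.toLp b) = ∫ t, b t * (starRingEnd ℂ) (a t) ∂ν := by
    intro a b ha hb
    rw [L2.inner_def]
    apply integral_congr_ae
    filter_upwards [ha.coeFn_toLp, hb.coeFn_toLp] with t h1 h2
    rw [h1, h2]
    simp
  let D : ℕ → WeakDual ℂ E := fun n =>
    StrongDual.toWeakDual (InnerProductSpace.toDual ℂ E ((hF n).toLp (F n)))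
  have hD : ∀ n, D n ∈ WeakDual.toStrongDual ⁻¹' Metric.closedBall (0 : StrongDual ℂ E) √C := by
    intro n
    rw [mem_preimage, mem_closedBall_zero_iff]
    change ‖InnerProductSpace.toDual ℂ E ((hF n).toLp (F n))‖ ≤ √C
    rw [LinearIsometryEquiv.norm_map]
    apply Real.le_sqrt_of_sq_le
    rw [← inner_self_eq_norm_sq (𝕜 := ℂ), hinner]
    refine le_trans (le_of_eq ?_) (hC n)
    have : (fun t => F n t * (starRingEnd ℂ) (F n t)) =
        fun t => ((‖F n t‖ ^ 2 : ℝ) : ℂ) := by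
      funext t
      rw [Complex.mul_conj, Complex.normSq_eq_norm_sq]
    rw [this, integral_complex_ofReal]
    simp
  -- Sequential Banach–Alaoglu, available because L² is separable.
  obtain ⟨d, -, k, hk, hlim⟩ := WeakDual.isSeqCompact_closedBall ℂ E 0 √C hD
  obtain ⟨G, hG⟩ := (InnerProductSpace.toDual ℂ E).surjective (WeakDual.toStrongDual d)
  refine ⟨G, Lp.memLp G, k, hk, fun ψ hψ => ?_⟩
  -- The pairing in the statement is bilinear while the inner product is sesquilinear, hence the two
  -- conjugations.
  have hψ' : MemLp (fun t => (starRingEnd ℂ) (ψ t)) 2 ν := hψ.star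
  have h1 := ((WeakDual.eval_continuous (hψ'.toLp _)).tendsto d).comp hlim
  have h2 := (Complex.continuous_conj.tendsto _).comp h1
  have e1 : ∀ n, (starRingEnd ℂ) (D n (hψ'.toLp _)) = ∫ t, ψ t * F n t ∂ν := by
    intro n
    have : D n (hψ'.toLp _) =
      inner ℂ ((hF n).toLp (F n)) (hψ'.toLp (fun t => (starRingEnd ℂ) (ψ t))) := rfl
    rw [this, inner_conj_symm, hinner hψ' (hF n)]
    simp [mul_comm]
  have e2 : (starRingEnd ℂ) (d (hψ'.toLp _)) = ∫ t, ψ t * G t ∂ν := by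
    have : d (hψ'.toLp _) = inner ℂ G (hψ'.toLp (fun t => (starRingEnd ℂ) (ψ t))) := by
      change WeakDual.toStrongDual d _ = _
      rw [← hG]
      rfl
    rw [this, inner_conj_symm]
    have hG' : (Lp.memLp G).toLp G = G := Lp.toLp_coeFn G _
    conv_lhs => rw [← hG']
    rw [hinner hψ' (Lp.memLp G)]
    simp [mul_comm]
  rw [e2] at h2
  exact h2.congr fun n => e1 _

theorem continuous_integral_of_memLp {g : ℝ → ℂ} (hg : MemLp g 2 (volume.restrict (Ioi 0)))
    (z : ℂ) : Continuous (fun x : ℝ≥0 => z + ∫ s in (0 : ℝ)..x, g s) := by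
  have hi : ∀ a b : ℝ, IntervalIntegrable ((Ioi (0 : ℝ)).indicator g) volume a b := by
    intro a b
    rw [intervalIntegrable_iff]
    have h1 := ((memLp_indicator_iff_restrict (p := 2) (μ := volume) measurableSet_Ioi).2 hg)
    have : IsFiniteMeasure (volume.restrict (uIoc a b)) :=
      ⟨by rw [Measure.restrict_apply_univ]; exact measure_Ioc_lt_top⟩
    exact (h1.mono_measure Measure.restrict_le_self).integrable one_le_two
  have hc := (intervalIntegral.continuous_primitive hi 0).comp NNReal.continuous_coe
  refine continuous_const.add (hc.congr fun x => ?_)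
  simp only [Function.comp_apply]
  rw [intervalIntegral.integral_of_le (NNReal.coe_nonneg x),
    intervalIntegral.integral_of_le (NNReal.coe_nonneg x)]
  exact setIntegral_congr_fun measurableSet_Ioc fun t ht => indicator_of_mem (mem_Ioi.2 ht.1) _

theorem eLpNorm_two_le {f : ℝ → ℂ} {ν : Measure ℝ} (hf : MemLp f 2 ν) {C : ℝ}
    (hC : ∫ t, ‖f t‖ ^ 2 ∂ν ≤ C) : eLpNorm f 2 ν ≤ ENNReal.ofReal √C := by
  rw [hf.eLpNorm_eq_integral_rpow_norm (by norm_num) (by norm_num)]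
  apply ENNReal.ofReal_le_ofReal
  rw [Real.sqrt_eq_rpow]
  have h0 : 0 ≤ ∫ t, ‖f t‖ ^ 2 ∂ν := integral_nonneg fun t => by positivity
  have := Real.rpow_le_rpow h0 hC (z := 1 / 2) (by norm_num)
  simpa using this

theorem norm_sq_onLine_le {f : ℝ → ℂ} (hfc : Continuous f) (hf : MemH1 f) {x : ℝ} (hx : 0 ≤ x) :
    ‖f x‖ ^ 2 ≤ 2 * (√(∫ t in Ioi (0 : ℝ), ‖f t‖ ^ 2) *
      √(∫ t in Ioi (0 : ℝ), ‖weakDeriv f t‖ ^ 2)) :=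
  (norm_sq_le_two_mul hfc hf.1 (weakDeriv_memLp hf) (weakDeriv_isWeakDeriv hf) hx).trans
    (mul_le_mul_of_nonneg_left (integral_norm_mul_norm_le hf.1 (weakDeriv_memLp hf)) zero_le_two)

theorem two_mul_norm_sq_onLine_le {f : ℝ → ℂ} (hfc : Continuous f) (hf : MemH1 f) {x : ℝ}
    (hx : 0 ≤ x) :
    2 * ‖f x‖ ^ 2 ≤ ‖f 0‖ ^ 2 + 2 * (√(∫ t in Ioi (0 : ℝ), ‖f t‖ ^ 2) *
      √(∫ t in Ioi (0 : ℝ), ‖weakDeriv f t‖ ^ 2)) :=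
  (two_mul_norm_sq_le hfc hf.1 (weakDeriv_memLp hf) (weakDeriv_isWeakDeriv hf) hx).trans
    (add_le_add_right (mul_le_mul_of_nonneg_left
      (integral_norm_mul_norm_le hf.1 (weakDeriv_memLp hf)) zero_le_two) _)

/-- Bounded sequences in `H¹(ℝ⁺)` have weakly convergent subsequences. -/
theorem exists_weak_subseq_memH1 {f : ℕ → C(ℝ≥0, ℂ)} (hf : ∀ n, MemH1 (onLine (f n))) {C : ℝ}
    (h1 : ∀ n, ∫ t in Ioi (0 : ℝ), ‖onLine (f n) t‖ ^ 2 ≤ C)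
    (h2 : ∀ n, ∫ t in Ioi (0 : ℝ), ‖weakDeriv (onLine (f n)) t‖ ^ 2 ≤ C) :
    ∃ h : C(ℝ≥0, ℂ), MemH1 (onLine h) ∧ ∃ k : ℕ → ℕ, StrictMono k ∧
      (∀ x, 0 ≤ x → Tendsto (fun j => onLine (f (k j)) x) atTop (𝓝 (onLine h x))) ∧
      ∀ ψ : ℝ → ℂ, MemLp ψ 2 (volume.restrict (Ioi 0)) →
        Tendsto (fun j => ∫ t in Ioi (0 : ℝ), ψ t * weakDeriv (onLine (f (k j))) t) atTop
          (𝓝 (∫ t in Ioi (0 : ℝ), ψ t * weakDeriv (onLine h) t)) := by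
  have hC : 0 ≤ C := (integral_nonneg fun t => by positivity).trans (h1 0)
  have hbd : ∀ n x, 0 ≤ x → ‖onLine (f n) x‖ ≤ √(2 * C) := fun n x hx => by
    apply Real.le_sqrt_of_sq_le
    refine (norm_sq_onLine_le (continuous_onLine _) (hf n) hx).trans ?_
    have := mul_le_mul (Real.sqrt_le_sqrt (h1 n)) (Real.sqrt_le_sqrt (h2 n)) (by positivity)
      (by positivity)
    rw [Real.mul_self_sqrt hC] at this
    linarith
  obtain ⟨g, hg, k₁, hk₁, hw⟩ := exists_weak_subseq (fun n => weakDeriv_memLp (hf n)) h2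
  obtain ⟨z, -, k₂, hk₂, hz⟩ := tendsto_subseq_of_bounded
    (Metric.isBounded_closedBall (x := (0 : ℂ)) (r := √(2 * C)))
    (x := fun j => onLine (f (k₁ j)) 0) (fun j => by simpa using hbd (k₁ j) 0 le_rfl)
  set k := k₁ ∘ k₂ with hkdef
  have hk : StrictMono k := hk₁.comp hk₂
  have hwk : ∀ ψ : ℝ → ℂ, MemLp ψ 2 (volume.restrict (Ioi 0)) →
        Tendsto (fun j => ∫ t in Ioi (0 : ℝ), ψ t * weakDeriv (onLine (f (k j))) t) atTop
          (𝓝 (∫ t in Ioi (0 : ℝ), ψ t * g t)) := fun ψ hψ => (hw ψ hψ).comp hk₂.tendsto_atTop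
  -- The limit is rebuilt from the limiting value at 0 and the weak limit of the derivatives.
  -- Testing with indicators of (0, x] then gives convergence at every point.
  let h : C(ℝ≥0, ℂ) := ⟨_, continuous_integral_of_memLp hg z⟩
  have hval : ∀ x : ℝ, 0 ≤ x → onLine h x = z + ∫ s in (0 : ℝ)..x, g s := by
    intro x hx
    simp [onLine, h, hx]
  have hpt : ∀ x, 0 ≤ x → Tendsto (fun j => onLine (f (k j)) x) atTop (𝓝 (onLine h x)) := by
    intro x hx
    have hind : ∀ q : ℝ → ℂ, ∫ t in Ioi (0 : ℝ), (Ioc 0 x).indicator (fun _ => (1 : ℂ)) t * q t =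
        ∫ t in (0 : ℝ)..x, q t := by
      intro q
      have : (fun t => (Ioc 0 x).indicator (fun _ => (1 : ℂ)) t * q t) = (Ioc 0 x).indicator q := by
        funext t
        by_cases ht : t ∈ Ioc 0 x
        · rw [indicator_of_mem ht, indicator_of_mem ht, one_mul]
        · rw [indicator_of_notMem ht, indicator_of_notMem ht, zero_mul]
      rw [this, setIntegral_indicator measurableSet_Ioc, inter_eq_right.2 Ioc_subset_Ioi_self,
        intervalIntegral.integral_of_le hx]
    have hψ : MemLp ((Ioc 0 x).indicator (fun _ => (1 : ℂ))) 2 (volume.restrict (Ioi (0 : ℝ))) := by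
      refine memLp_indicator_const 2 measurableSet_Ioc 1 (Or.inr ?_)
      exact ((Measure.restrict_apply_le _ _).trans_lt measure_Ioc_lt_top).ne
    have := hz.add (hwk _ hψ)
    rw [hind, ← hval x hx] at this
    refine this.congr fun j => ?_
    rw [hind, ← (weakDeriv_isWeakDeriv (hf _)).sub_eq_integral (continuous_onLine _)
      (weakDeriv_memLp (hf _)) le_rfl hx]
    simp [hkdef]
  have hh2 : MemLp (onLine h) 2 (volume.restrict (Ioi 0)) := by
    refine ⟨(continuous_onLine h).aestronglyMeasurable, ?_⟩
    refine (Lp.eLpNorm_lim_le_liminf_eLpNorm (f := fun j => onLine (f (k j)))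
      (fun j => (hf _).1.1) (onLine h) ?_).trans_lt ?_
    · filter_upwards [ae_restrict_mem measurableSet_Ioi] with t ht
      exact hpt t (le_of_lt ht)
    · refine lt_of_le_of_lt ?_ (ENNReal.ofReal_lt_top (r := √C))
      refine (liminf_le_liminf (v := fun _ => ENNReal.ofReal √C)
        (Eventually.of_forall fun j => eLpNorm_two_le (hf (k j)).1 (h1 (k j)))).trans ?_
      rw [liminf_const]
  have hwd : IsWeakDeriv (onLine h) g := by
    intro φ hφ hc hs
    have hφ2 : MemLp (fun x => (φ x : ℂ)) 2 (volume.restrict (Ioi (0 : ℝ))) :=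
      (Complex.continuous_ofReal.comp hφ.continuous).memLp_of_hasCompactSupport
        (hc.comp_left (g := fun t : ℝ => (t : ℂ)) (by simp))
    have hd : Continuous (deriv φ) := hφ.continuous_deriv (by norm_cast)
    refine tendsto_nhds_unique ?_ (hwk _ hφ2).neg
    have : Tendsto (fun j => ∫ x in Ioi (0 : ℝ), ((deriv φ x : ℝ) : ℂ) * onLine (f (k j)) x) atTop
        (𝓝 (∫ x in Ioi (0 : ℝ), ((deriv φ x : ℝ) : ℂ) * onLine h x)) := by
      refine tendsto_integral_of_dominated_convergence (fun t => |deriv φ t| * √(2 * C)) ?_ ?_ ?_ ?_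
      · intro j
        exact ((Complex.continuous_ofReal.comp hd).mul
          (continuous_onLine _)).aestronglyMeasurable
      · exact (((hd.integrable_of_hasCompactSupport hc.deriv).abs).mul_const _).restrict
      · intro j
        filter_upwards [ae_restrict_mem measurableSet_Ioi] with t ht
        rw [norm_mul, Complex.norm_real, Real.norm_eq_abs]
        exact mul_le_mul_of_nonneg_left (hbd _ t (le_of_lt ht)) (abs_nonneg _)
      · filter_upwards [ae_restrict_mem measurableSet_Ioi] with t ht
        exact (hpt t (le_of_lt ht)).const_mul _
    exact this.congr fun j => weakDeriv_isWeakDeriv (hf _) φ hφ hc hs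
  have hH : MemH1 (onLine h) := ⟨hh2, g, hg, hwd⟩
  refine ⟨h, hH, k, hk, hpt, fun ψ hψ => ?_⟩
  -- The chosen derivative of the limit agrees with `g` only almost everywhere.
  have hae := (weakDeriv_isWeakDeriv hH).ae_eq (weakDeriv_memLp hH) hg hwd
  have : ∫ t in Ioi (0 : ℝ), ψ t * weakDeriv (onLine h) t = ∫ t in Ioi (0 : ℝ), ψ t * g t := by
    apply integral_congr_ae
    filter_upwards [hae] with t ht
    rw [ht]
  rw [this]
  exact hwk ψ hψ

/-- Pointwise convergence plus an L² bound suffices: |b||r| - δ|r|² is at most |b|²/(4δ), so its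
positive part goes to 0 by dominated convergence, and the part subtracted costs at most δC. -/
theorem tendsto_integral_norm_mul_norm {α : Type*} [MeasurableSpace α] {ν : Measure α}
    {b : α → ℂ} {r : ℕ → α → ℂ} {C : ℝ} (hb : MemLp b 2 ν) (hr : ∀ n, MemLp (r n) 2 ν)
    (hC : ∀ n, ∫ t, ‖r n t‖ ^ 2 ∂ν ≤ C)
    (h0 : ∀ᵐ t ∂ν, Tendsto (fun n => r n t) atTop (𝓝 0)) :
    Tendsto (fun n => ∫ t, ‖b t‖ * ‖r n t‖ ∂ν) atTop (𝓝 0) := by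
  have hC0 : 0 ≤ C := (integral_nonneg fun t => by positivity).trans (hC 0)
  rw [Metric.tendsto_atTop]
  intro ε hε
  set δ : ℝ := ε / (2 * (C + 1)) with hδ
  have hδ0 : 0 < δ := by positivity
  have hi : ∀ n, Integrable (fun t => ‖b t‖ * ‖r n t‖ - δ * ‖r n t‖ ^ 2) ν := fun n =>
    (integrable_norm_mul_norm hb (hr n)).sub ((integrable_norm_sq (hr n)).const_mul δ)
  have hlim : Tendsto (fun n => ∫ t, max (‖b t‖ * ‖r n t‖ - δ * ‖r n t‖ ^ 2) 0 ∂ν) atTop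
      (𝓝 (∫ _, (0 : ℝ) ∂ν)) := by
    refine tendsto_integral_of_dominated_convergence (fun t => ‖b t‖ ^ 2 * (4 * δ)⁻¹) ?_ ?_ ?_ ?_
    · exact fun n => (hi n).pos_part.1
    · exact (integrable_norm_sq hb).mul_const _
    · refine fun n => Eventually.of_forall fun t => ?_
      rw [Real.norm_of_nonneg (le_max_right _ _)]
      refine max_le ?_ (by positivity)
      rw [← div_eq_mul_inv, le_div_iff₀ (by positivity)]
      nlinarith [sq_nonneg (‖b t‖ - 2 * δ * ‖r n t‖)]
    · filter_upwards [h0] with t ht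
      have h1 := ((ht.norm.const_mul ‖b t‖).sub ((ht.norm.pow 2).const_mul δ)).max
        (tendsto_const_nhds (x := (0 : ℝ)))
      simpa using h1
  rw [integral_zero, Metric.tendsto_atTop] at hlim
  obtain ⟨M, hM⟩ := hlim (ε / 2) (by positivity)
  refine ⟨M, fun n hn => ?_⟩
  have hp := hM n hn
  rw [Real.dist_eq, sub_zero] at hp ⊢
  have hp' := (le_abs_self _).trans_lt hp
  rw [abs_of_nonneg (integral_nonneg fun t => by positivity)]
  have hle : ∫ t, ‖b t‖ * ‖r n t‖ ∂ν ≤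
      (∫ t, max (‖b t‖ * ‖r n t‖ - δ * ‖r n t‖ ^ 2) 0 ∂ν) + δ * ∫ t, ‖r n t‖ ^ 2 ∂ν := by
    rw [← integral_const_mul, ← integral_add (hi n).pos_part
      ((integrable_norm_sq (hr n)).const_mul δ)]
    refine integral_mono (integrable_norm_mul_norm hb (hr n))
      ((hi n).pos_part.add ((integrable_norm_sq (hr n)).const_mul δ)) fun t => ?_
    have := le_max_left (‖b t‖ * ‖r n t‖ - δ * ‖r n t‖ ^ 2) 0
    simp only
    linarith
  have h3 : δ * ∫ t, ‖r n t‖ ^ 2 ∂ν ≤ δ * (C + 1) :=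
    mul_le_mul_of_nonneg_left ((hC n).trans (by linarith)) hδ0.le
  have h4 : δ * (C + 1) = ε / 2 := by
    rw [hδ]
    field_simp
  linarith

/-! ### Exponential profiles -/

/-- The edge function `x ↦ A exp (-κ x)`. -/
def expEdge (A κ : ℝ) : C(ℝ≥0, ℂ) :=
  ⟨fun x => ((A * Real.exp (-κ * x) : ℝ) : ℂ), by fun_prop⟩

theorem onLine_expEdge (A κ : ℝ) {x : ℝ} (hx : 0 ≤ x) :
    onLine (expEdge A κ) x = ((A * Real.exp (-κ * x) : ℝ) : ℂ) := by
  simp [onLine, expEdge, hx]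

theorem integrableOn_exp_pow (A : ℝ) {κ : ℝ} (hκ : 0 < κ) {p : ℕ} (hp : p ≠ 0) :
    IntegrableOn (fun x : ℝ => (A * Real.exp (-κ * x)) ^ p) (Ioi 0) := by
  have : (fun x : ℝ => (A * Real.exp (-κ * x)) ^ p) =
      fun x => A ^ p * Real.exp ((-(p * κ)) * x) := by
    funext x
    rw [mul_pow, ← Real.exp_nat_mul]
    congr 2
    ring
  rw [this]
  have hp' : (0 : ℝ) < p := by exact_mod_cast Nat.pos_of_ne_zero hp
  exact (integrableOn_exp_mul_Ioi (by nlinarith) 0).const_mul _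

theorem integral_exp_pow (A : ℝ) {κ : ℝ} (hκ : 0 < κ) {p : ℕ} (hp : p ≠ 0) :
    ∫ x in Ioi (0 : ℝ), (A * Real.exp (-κ * x)) ^ p = A ^ p / (p * κ) := by
  have : (fun x : ℝ => (A * Real.exp (-κ * x)) ^ p) =
      fun x => A ^ p * Real.exp ((-(p * κ)) * x) := by
    funext x
    rw [mul_pow, ← Real.exp_nat_mul]
    congr 2
    ring
  have hp' : (0 : ℝ) < p := by exact_mod_cast Nat.pos_of_ne_zero hp
  rw [this, integral_const_mul, integral_exp_mul_Ioi (by nlinarith)]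
  simp
  ring

theorem memLp_exp (A : ℝ) {κ : ℝ} (hκ : 0 < κ) :
    MemLp (fun x : ℝ => ((A * Real.exp (-κ * x) : ℝ) : ℂ)) 2 (volume.restrict (Ioi 0)) := by
  rw [memLp_two_iff_integrable_sq_norm (by fun_prop)]
  refine (integrableOn_exp_pow A hκ two_ne_zero).congr ?_
  refine Eventually.of_forall fun x => ?_
  simp only [Complex.norm_real, Real.norm_eq_abs, sq_abs]

theorem isWeakDeriv_expEdge (A κ : ℝ) :
    IsWeakDeriv (onLine (expEdge A κ)) (fun x => ((-κ * A * Real.exp (-κ * x) : ℝ) : ℂ)) := by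
  intro φ hφ hc hs
  have hd : Continuous (deriv φ) := hφ.continuous_deriv (by norm_cast)
  have hφ0 : ∀ x, x ∉ Ioi (0 : ℝ) → φ x = 0 := fun x hx =>
    image_eq_zero_of_notMem_tsupport fun hcon => hx (hs hcon)
  have hφd0 : ∀ x, x ∉ Ioi (0 : ℝ) → deriv φ x = 0 := fun x hx => by
    by_contra hcon
    exact hx (hs (support_deriv_subset (Function.mem_support.2 hcon)))
  have e1 : ∫ x in Ioi (0 : ℝ), ((deriv φ x : ℝ) : ℂ) * onLine (expEdge A κ) x =
      ∫ x, ((deriv φ x : ℝ) : ℂ) * ((A * Real.exp (-κ * x) : ℝ) : ℂ) := by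
    refine Eq.trans ?_ (setIntegral_eq_integral_of_forall_compl_eq_zero (s := Ioi (0 : ℝ))
      (fun x hx => by rw [hφd0 x hx]; simp))
    refine setIntegral_congr_fun measurableSet_Ioi fun x hx => ?_
    simp only [onLine_expEdge A κ (le_of_lt hx)]
  rw [e1, setIntegral_eq_integral_of_forall_compl_eq_zero
    (fun x hx => by rw [hφ0 x hx]; simp)]
  have h1 : ∀ x, HasDerivAt (fun x => (φ x : ℂ)) ((deriv φ x : ℝ) : ℂ) x := fun x =>
    ((hφ.differentiable (by simp)) x).hasDerivAt.ofReal_comp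
  have h2 : ∀ x, HasDerivAt (fun x : ℝ => ((A * Real.exp (-κ * x) : ℝ) : ℂ))
      ((-κ * A * Real.exp (-κ * x) : ℝ) : ℂ) x := fun x => by
    have : HasDerivAt (fun x : ℝ => A * Real.exp (-κ * x)) (-κ * A * Real.exp (-κ * x)) x := by
      have h3 := (((hasDerivAt_id x).const_mul (-κ)).exp).const_mul A
      refine h3.congr_deriv ?_
      simp only [id, mul_one]
      ring
    exact this.ofReal_comp
  have hcφ : HasCompactSupport (fun x => (φ x : ℂ)) :=
    hc.comp_left (g := fun t : ℝ => (t : ℂ)) (by simp)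
  have hcd : HasCompactSupport (fun x => ((deriv φ x : ℝ) : ℂ)) :=
    hc.deriv.comp_left (g := fun t : ℝ => (t : ℂ)) (by simp)
  have hφc := hφ.continuous
  have i1 : Integrable (fun x => (φ x : ℂ) * ((-κ * A * Real.exp (-κ * x) : ℝ) : ℂ)) :=
    Continuous.integrable_of_hasCompactSupport (by fun_prop) hcφ.mul_right
  have i2 : Integrable (fun x => ((deriv φ x : ℝ) : ℂ) * ((A * Real.exp (-κ * x) : ℝ) : ℂ)) :=
    Continuous.integrable_of_hasCompactSupport (by fun_prop) hcd.mul_right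
  have i3 : Integrable (fun x => (φ x : ℂ) * ((A * Real.exp (-κ * x) : ℝ) : ℂ)) :=
    Continuous.integrable_of_hasCompactSupport (by fun_prop) hcφ.mul_right
  have := integral_mul_deriv_eq_deriv_mul_of_integrable (fun x _ => h1 x) (fun x _ => h2 x) i1 i2 i3
  rw [this, neg_neg]

theorem memH1_expEdge (A : ℝ) {κ : ℝ} (hκ : 0 < κ) : MemH1 (onLine (expEdge A κ)) := by
  refine ⟨(memLp_congr_ae ?_).1 (memLp_exp A hκ), _, memLp_exp (-κ * A) hκ,
    isWeakDeriv_expEdge A κ⟩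
  filter_upwards [ae_restrict_mem measurableSet_Ioi] with x hx
  exact (onLine_expEdge A κ (le_of_lt hx)).symm

theorem integral_norm_expEdge_pow {A : ℝ} (hA : 0 ≤ A) {κ : ℝ} (hκ : 0 < κ) {p : ℕ} (hp : p ≠ 0) :
    ∫ x in Ioi (0 : ℝ), ‖onLine (expEdge A κ) x‖ ^ p = A ^ p / (p * κ) := by
  rw [← integral_exp_pow A hκ hp]
  refine setIntegral_congr_fun measurableSet_Ioi fun x hx => ?_
  simp only [onLine_expEdge A κ (le_of_lt hx)]
  rw [Complex.norm_real, Real.norm_of_nonneg (by positivity)]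

theorem integral_norm_weakDeriv_expEdge_sq (A : ℝ) {κ : ℝ} (hκ : 0 < κ) :
    ∫ x in Ioi (0 : ℝ), ‖weakDeriv (onLine (expEdge A κ)) x‖ ^ 2 = κ * A ^ 2 / 2 := by
  have hH := memH1_expEdge A hκ
  have hae := (weakDeriv_isWeakDeriv hH).ae_eq (weakDeriv_memLp hH) (memLp_exp (-κ * A) hκ)
    (isWeakDeriv_expEdge A κ)
  have : κ * A ^ 2 / 2 = (-κ * A) ^ 2 / ((2 : ℕ) * κ) := by
    push_cast
    field_simp
  rw [this, ← integral_exp_pow (-κ * A) hκ two_ne_zero]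
  apply integral_congr_ae
  filter_upwards [hae] with x hx
  rw [hx, Complex.norm_real, Real.norm_eq_abs, sq_abs]

/-! ### Norms and elementary estimates on the graph -/

/-- The kinetic energy `‖u'‖₂²`. -/
def kinetic {N : ℕ} (u : H1 N) : ℝ := normPow 2 (der u)

/-- The energy of a single component, with cubic coefficient one. -/
def scalarEnergy {N : ℕ} [NeZero N] (γ : ℝ) (u : H1 N) : ℝ :=
  kinetic u - γ * ‖comp u 0 0‖ ^ 2 - 1 / 2 * normPow 4 (comp u)

section Basic

variable {N : ℕ}

theorem comp_sub (u v : H1 N) (e : Fin N) (x : ℝ) :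
    comp (u - v) e x = comp u e x - comp v e x := rfl

theorem comp_smul (k : ℂ) (u : H1 N) (e : Fin N) (x : ℝ) :
    comp (k • u) e x = k * comp u e x := rfl

theorem memH1_comp (u : H1 N) (e : Fin N) : MemH1 (comp u e) := u.2.2 e

theorem continuous_comp (u : H1 N) (e : Fin N) : Continuous (comp u e) := continuous_onLine _

theorem comp_zero_eq [NeZero N] (u : H1 N) (e : Fin N) : comp u e 0 = comp u 0 0 := by
  have := u.2.1 e 0
  simpa [comp, onLine] using this

theorem memLp_der (u : H1 N) (e : Fin N) : MemLp (der u e) 2 (volume.restrict (Ioi 0)) :=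
  weakDeriv_memLp (memH1_comp u e)

theorem isWeakDeriv_der (u : H1 N) (e : Fin N) : IsWeakDeriv (comp u e) (der u e) :=
  weakDeriv_isWeakDeriv (memH1_comp u e)

theorem der_smul_ae (k : ℂ) (u : H1 N) (e : Fin N) :
    der (k • u) e =ᵐ[volume.restrict (Ioi 0)] k • der u e :=
  (isWeakDeriv_der (k • u) e).ae_eq (memLp_der _ e) ((memLp_der u e).const_smul k)
    ((isWeakDeriv_der u e).const_smul k)

theorem der_sub_ae (u v : H1 N) (e : Fin N) :
    der (u - v) e =ᵐ[volume.restrict (Ioi 0)] der u e - der v e := by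
  have h := IsWeakDeriv.add (memH1_comp u e).1 ((memH1_comp v e).1.const_smul (-1 : ℂ))
    (memLp_der u e) ((memLp_der v e).const_smul (-1 : ℂ)) (isWeakDeriv_der u e)
    ((isWeakDeriv_der v e).const_smul (-1))
  rw [neg_one_smul, neg_one_smul, ← sub_eq_add_neg, ← sub_eq_add_neg] at h
  exact (isWeakDeriv_der (u - v) e).ae_eq (memLp_der _ e) ((memLp_der u e).sub (memLp_der v e)) h

theorem normPow_nonneg (p : ℕ) (f : Fin N → ℝ → ℂ) : 0 ≤ normPow p f :=
  Finset.sum_nonneg fun _ _ => integral_nonneg fun _ => by positivity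

theorem mass_nonneg (u : H1 N) : 0 ≤ mass u := normPow_nonneg _ _

theorem kinetic_nonneg (u : H1 N) : 0 ≤ kinetic u := normPow_nonneg _ _

theorem integral_le_normPow (p : ℕ) (f : Fin N → ℝ → ℂ) (e : Fin N) :
    ∫ x in Ioi (0 : ℝ), ‖f e x‖ ^ p ≤ normPow p f :=
  Finset.single_le_sum (f := fun e => ∫ x in Ioi (0 : ℝ), ‖f e x‖ ^ p)
    (fun _ _ => integral_nonneg fun _ => by positivity) (Finset.mem_univ e)

theorem normPow_comp_smul (p : ℕ) (k : ℂ) (u : H1 N) :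
    normPow p (comp (k • u)) = ‖k‖ ^ p * normPow p (comp u) := by
  simp only [normPow, comp_smul, norm_mul, mul_pow, integral_const_mul, Finset.mul_sum]

theorem mass_smul (k : ℂ) (u : H1 N) : mass (k • u) = ‖k‖ ^ 2 * mass u :=
  normPow_comp_smul 2 k u

theorem kinetic_smul (k : ℂ) (u : H1 N) : kinetic (k • u) = ‖k‖ ^ 2 * kinetic u := by
  simp only [kinetic, normPow, Finset.mul_sum, ← integral_const_mul]
  refine Finset.sum_congr rfl fun e _ => integral_congr_ae ?_
  filter_upwards [der_smul_ae k u e] with x hx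
  rw [hx, Pi.smul_apply, smul_eq_mul, norm_mul, mul_pow]

theorem sqrt_mul_sqrt_edge_le (u : H1 N) (e : Fin N) :
    √(∫ t in Ioi (0 : ℝ), ‖comp u e t‖ ^ 2) * √(∫ t in Ioi (0 : ℝ), ‖weakDeriv (comp u e) t‖ ^ 2) ≤
      √(mass u) * √(kinetic u) :=
  mul_le_mul (Real.sqrt_le_sqrt (integral_le_normPow 2 (comp u) e))
    (Real.sqrt_le_sqrt (integral_le_normPow 2 (der u) e)) (by positivity) (by positivity)

theorem norm_sq_comp_le (u : H1 N) (e : Fin N) {x : ℝ} (hx : 0 ≤ x) :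
    ‖comp u e x‖ ^ 2 ≤ 2 * (√(mass u) * √(kinetic u)) :=
  (norm_sq_onLine_le (continuous_comp u e) (memH1_comp u e) hx).trans
    (mul_le_mul_of_nonneg_left (sqrt_mul_sqrt_edge_le u e) zero_le_two)

/-- Isolating the vertex value halves the factor of `norm_sq_comp_le`; this is what produces the
constant 1/16 in the energy bound. -/
theorem norm_sq_comp_le_vertex [NeZero N] (u : H1 N) (e : Fin N) {x : ℝ} (hx : 0 ≤ x) :
    ‖comp u e x‖ ^ 2 ≤ 1 / 2 * ‖comp u 0 0‖ ^ 2 + √(mass u) * √(kinetic u) := by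
  have h1 := two_mul_norm_sq_onLine_le (continuous_comp u e) (memH1_comp u e) hx
  have h2 := sqrt_mul_sqrt_edge_le u e
  rw [comp_zero_eq] at h1
  linarith

theorem normPow_four_le (u : H1 N) {S : ℝ} (hS : ∀ e x, 0 ≤ x → ‖comp u e x‖ ^ 2 ≤ S) :
    normPow 4 (comp u) ≤ S * mass u := by
  simp only [mass, normPow, Finset.mul_sum, ← integral_const_mul]
  refine Finset.sum_le_sum fun e _ => ?_
  refine integral_mono_of_nonneg (Eventually.of_forall fun x => by positivity)
    ((integrable_norm_sq (memH1_comp u e).1).const_mul S) ?_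
  filter_upwards [ae_restrict_mem measurableSet_Ioi] with x hx
  nlinarith [hS e x (le_of_lt hx), sq_nonneg ‖comp u e x‖]

/-- Products of four components, grouped in pairs, are integrable. -/
theorem integrable_norm_sq_mul_norm_sq (u v : H1 N) (e : Fin N) :
    Integrable (fun x => ‖comp u e x‖ ^ 2 * ‖comp v e x‖ ^ 2) (volume.restrict (Ioi 0)) := by
  refine ((integrable_norm_sq (memH1_comp v e).1).const_mul
    (2 * (√(mass u) * √(kinetic u)))).mono' ?_ ?_
  · exact (((continuous_comp u e).norm.pow 2).mul
      ((continuous_comp v e).norm.pow 2)).aestronglyMeasurable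
  · filter_upwards [ae_restrict_mem measurableSet_Ioi] with x hx
    rw [Real.norm_of_nonneg (by positivity)]
    exact mul_le_mul_of_nonneg_right (norm_sq_comp_le u e (le_of_lt hx)) (by positivity)

theorem integrable_norm_pow_four (u : H1 N) (e : Fin N) :
    Integrable (fun x => ‖comp u e x‖ ^ 4) (volume.restrict (Ioi 0)) := by
  refine (integrable_norm_sq_mul_norm_sq u u e).congr (Eventually.of_forall fun x => ?_)
  simp only
  ring

theorem normPow_two_sub_le {f g h : Fin N → ℝ → ℂ}
    (hf : ∀ e, MemLp (f e) 2 (volume.restrict (Ioi 0)))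
    (hg : ∀ e, MemLp (g e) 2 (volume.restrict (Ioi 0)))
    (hh : ∀ e, h e =ᵐ[volume.restrict (Ioi 0)] f e - g e) :
    normPow 2 h ≤ 2 * normPow 2 f + 2 * normPow 2 g := by
  simp only [normPow, Finset.mul_sum, ← integral_const_mul, ← Finset.sum_add_distrib]
  refine Finset.sum_le_sum fun e _ => ?_
  have i1 := (integrable_norm_sq (hf e)).const_mul 2
  have i2 := (integrable_norm_sq (hg e)).const_mul 2
  rw [← integral_add i1 i2]
  refine integral_mono_of_nonneg (Eventually.of_forall fun x => by positivity) (i1.add i2) ?_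
  filter_upwards [hh e] with x hx
  rw [hx]
  have h3 := norm_sub_le (f e x) (g e x)
  have h4 : ‖f e x - g e x‖ ^ 2 ≤ (‖f e x‖ + ‖g e x‖) ^ 2 := by gcongr
  simp only [Pi.sub_apply]
  nlinarith [sq_nonneg (‖f e x‖ - ‖g e x‖)]

theorem mass_sub_le (u v : H1 N) : mass (u - v) ≤ 2 * mass u + 2 * mass v :=
  normPow_two_sub_le (fun e => (memH1_comp u e).1) (fun e => (memH1_comp v e).1)
    fun _ => EventuallyEq.rfl

theorem kinetic_sub_le (u v : H1 N) : kinetic (u - v) ≤ 2 * kinetic u + 2 * kinetic v :=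
  normPow_two_sub_le (fun e => memLp_der u e) (fun e => memLp_der v e) fun e => der_sub_ae u v e

end Basic

/-! ### Splitting of norms along weakly convergent sequences -/

section Splitting

theorem abs_sq_sub_sq_sub_sq_le (a b : ℂ) :
    |‖a‖ ^ 2 - ‖a - b‖ ^ 2 - ‖b‖ ^ 2| ≤ 2 * (‖b‖ * ‖a - b‖) := by
  have h1 : ‖a‖ ≤ ‖a - b‖ + ‖b‖ := by simpa using norm_add_le (a - b) b
  have h2 : ‖b‖ ≤ ‖a‖ + ‖a - b‖ := by simpa using norm_sub_le a (a - b)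
  have h3 : ‖a - b‖ ≤ ‖a‖ + ‖b‖ := norm_sub_le a b
  have := norm_nonneg a
  have := norm_nonneg b
  have := norm_nonneg (a - b)
  rw [abs_le]
  constructor
  · have : |‖a - b‖ - ‖b‖| ≤ ‖a‖ := by rw [abs_le]; constructor <;> linarith
    have := pow_le_pow_left₀ (abs_nonneg _) this 2
    rw [sq_abs] at this
    nlinarith
  · nlinarith

/-- Write ‖a‖² = ‖a - b‖² + ‖b‖² + s with |s| ≤ 2‖b‖‖a - b‖ and square. The cross term contributes 4
to the constant; the other two contribute 3 after 2BR ≤ B² + R². -/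
theorem abs_pow_four_sub_sub_le (a b : ℂ) :
    |‖a‖ ^ 4 - ‖a - b‖ ^ 4 - ‖b‖ ^ 4| ≤
      7 * (‖b‖ ^ 2 + ‖a - b‖ ^ 2) * (‖b‖ * ‖a - b‖) := by
  have h := abs_sq_sub_sq_sub_sq_le a b
  set A := ‖a‖
  set B := ‖b‖ with hB
  set R := ‖a - b‖ with hR
  have hB0 : 0 ≤ B := norm_nonneg b
  have hR0 : 0 ≤ R := norm_nonneg _
  set s := A ^ 2 - R ^ 2 - B ^ 2 with hs
  have e : A ^ 4 - R ^ 4 - B ^ 4 = 2 * (B * R) ^ 2 + 2 * s * (B ^ 2 + R ^ 2) + s ^ 2 := by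
    rw [hs]; ring
  have hBR : 0 ≤ B * R := by positivity
  have h1 : |2 * s * (B ^ 2 + R ^ 2)| ≤ 4 * (B * R) * (B ^ 2 + R ^ 2) := by
    rw [abs_mul, abs_mul, abs_two, abs_of_nonneg (by positivity : 0 ≤ B ^ 2 + R ^ 2)]
    nlinarith [sq_nonneg B, sq_nonneg R]
  have h2 : s ^ 2 ≤ 4 * (B * R) ^ 2 := by
    rw [← sq_abs]
    nlinarith [abs_nonneg s]
  have h3 : 2 * (B * R) ≤ B ^ 2 + R ^ 2 := by nlinarith [sq_nonneg (B - R)]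
  have h4 : 6 * (B * R) ^ 2 ≤ 3 * (B ^ 2 + R ^ 2) * (B * R) := by nlinarith
  rw [e, abs_le]
  rw [abs_le] at h1
  constructor <;> nlinarith [sq_nonneg s, sq_nonneg (B * R)]

/-- A Brezis-Lieb type splitting on a measure space. -/
theorem tendsto_integral_pow_sub {α : Type*} [MeasurableSpace α] {ν : Measure α} {p : ℕ}
    {f : ℕ → α → ℂ} {b : α → ℂ} {C K : ℝ} (hf : ∀ n, MemLp (f n) 2 ν) (hb : MemLp b 2 ν)
    (hC : ∀ n, ∫ t, ‖f n t - b t‖ ^ 2 ∂ν ≤ C)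
    (h0 : ∀ᵐ t ∂ν, Tendsto (fun n => f n t) atTop (𝓝 (b t)))
    (hfp : ∀ n, Integrable (fun t => ‖f n t‖ ^ p) ν) (hbp : Integrable (fun t => ‖b t‖ ^ p) ν)
    (hrp : ∀ n, Integrable (fun t => ‖f n t - b t‖ ^ p) ν)
    (hK : ∀ n, ∀ᵐ t ∂ν, |‖f n t‖ ^ p - ‖f n t - b t‖ ^ p - ‖b t‖ ^ p| ≤
      K * (‖b t‖ * ‖f n t - b t‖)) :
    Tendsto (fun n => (∫ t, ‖f n t‖ ^ p ∂ν) - ∫ t, ‖f n t - b t‖ ^ p ∂ν) atTop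
      (𝓝 (∫ t, ‖b t‖ ^ p ∂ν)) := by
  have hr : ∀ n, MemLp (fun t => f n t - b t) 2 ν := fun n => (hf n).sub hb
  have hlim := (tendsto_integral_norm_mul_norm hb hr hC (by
    filter_upwards [h0] with t ht
    simpa using ht.sub_const (b t))).const_mul K
  rw [mul_zero] at hlim
  rw [tendsto_iff_norm_sub_tendsto_zero]
  refine squeeze_zero (fun n => norm_nonneg _) (fun n => ?_) hlim
  have hi : Integrable (fun t => ‖f n t‖ ^ p - ‖f n t - b t‖ ^ p) ν := (hfp n).sub (hrp n)
  rw [← integral_sub (hfp n) (hrp n), ← integral_sub hi hbp, ← integral_const_mul]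
  exact norm_integral_le_of_norm_le ((integrable_norm_mul_norm hb (hr n)).const_mul K) (hK n)

/-- Weak convergence splits the square of the norm. -/
theorem tendsto_integral_sq_sub_of_weak {α : Type*} [MeasurableSpace α] {ν : Measure α}
    {f : ℕ → α → ℂ} {b : α → ℂ} (hf : ∀ n, MemLp (f n) 2 ν) (hb : MemLp b 2 ν)
    (hw : ∀ ψ : α → ℂ, MemLp ψ 2 ν →
      Tendsto (fun n => ∫ t, ψ t * f n t ∂ν) atTop (𝓝 (∫ t, ψ t * b t ∂ν))) :
    Tendsto (fun n => (∫ t, ‖f n t‖ ^ 2 ∂ν) - ∫ t, ‖f n t - b t‖ ^ 2 ∂ν) atTop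
      (𝓝 (∫ t, ‖b t‖ ^ 2 ∂ν)) := by
  have hb' : MemLp (fun t => (starRingEnd ℂ) (b t)) 2 ν := hb.star
  -- Polarization: the only term depending on n is linear in `f n`, so weak convergence is enough.
  -- This serves the derivatives, for which no pointwise convergence is known.
  have key : ∀ n, (∫ t, ‖f n t‖ ^ 2 ∂ν) - ∫ t, ‖f n t - b t‖ ^ 2 ∂ν =
      2 * (∫ t, (starRingEnd ℂ) (b t) * f n t ∂ν).re - ∫ t, ‖b t‖ ^ 2 ∂ν := by
    intro n
    have hi : Integrable (fun t => (starRingEnd ℂ) (b t) * f n t) ν := hb'.integrable_mul (hf n)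
    have hre : (∫ t, (starRingEnd ℂ) (b t) * f n t ∂ν).re =
        ∫ t, ((starRingEnd ℂ) (b t) * f n t).re ∂ν :=
      (Complex.reCLM.integral_comp_comm hi).symm
    have hi2 : Integrable (fun t => ‖f n t - b t‖ ^ 2) ν := integrable_norm_sq ((hf n).sub hb)
    have hi3 : Integrable (fun t => 2 * ((starRingEnd ℂ) (b t) * f n t).re) ν :=
      hi.re.const_mul 2
    rw [hre, ← integral_sub (integrable_norm_sq (hf n)) hi2,
      ← integral_const_mul, ← integral_sub hi3 (integrable_norm_sq hb)]
    congr 1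
    funext t
    simp only [Complex.sq_norm, Complex.normSq_apply, Complex.mul_re, Complex.conj_re,
      Complex.conj_im, Complex.sub_re, Complex.sub_im]
    ring
  have hb2 : (∫ t, (starRingEnd ℂ) (b t) * b t ∂ν).re = ∫ t, ‖b t‖ ^ 2 ∂ν := by
    have : (∫ t, (starRingEnd ℂ) (b t) * b t ∂ν).re = ∫ t, ((starRingEnd ℂ) (b t) * b t).re ∂ν :=
      (Complex.reCLM.integral_comp_comm (hb'.integrable_mul hb)).symm
    rw [this]
    congr 1
    funext t
    simp only [Complex.sq_norm, Complex.normSq_apply, Complex.mul_re, Complex.conj_re,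
      Complex.conj_im]
    ring
  have hlim := (((Complex.continuous_re.tendsto _).comp (hw _ hb')).const_mul 2).sub_const
    (∫ t, ‖b t‖ ^ 2 ∂ν)
  rw [hb2] at hlim
  have e : 2 * (∫ t, ‖b t‖ ^ 2 ∂ν) - ∫ t, ‖b t‖ ^ 2 ∂ν = ∫ t, ‖b t‖ ^ 2 ∂ν := by ring
  rw [e] at hlim
  exact hlim.congr fun n => (key n).symm

variable {N : ℕ}

/-- There are finitely many edges, so successive extraction gives one subsequence for all of them.
-/
theorem exists_weak_subseq_edges {u : ℕ → H1 N} {C : ℝ} (hm : ∀ n, mass (u n) ≤ C)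
    (hd : ∀ n, kinetic (u n) ≤ C) (s : Finset (Fin N)) :
    ∃ k : ℕ → ℕ, StrictMono k ∧ ∀ e ∈ s, ∃ h : C(ℝ≥0, ℂ), MemH1 (onLine h) ∧
      (∀ x, 0 ≤ x → Tendsto (fun j => comp (u (k j)) e x) atTop (𝓝 (onLine h x))) ∧
      ∀ ψ : ℝ → ℂ, MemLp ψ 2 (volume.restrict (Ioi 0)) →
        Tendsto (fun j => ∫ t in Ioi (0 : ℝ), ψ t * der (u (k j)) e t) atTop
          (𝓝 (∫ t in Ioi (0 : ℝ), ψ t * weakDeriv (onLine h) t)) := by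
  induction s using Finset.induction_on with
  | empty => exact ⟨id, strictMono_id, by simp⟩
  | insert e s _ ih =>
    obtain ⟨k, hk, hks⟩ := ih
    obtain ⟨h, hh, l, hl, hpt, hw⟩ := exists_weak_subseq_memH1 (f := fun n => (u (k n)).1 e)
      (fun n => memH1_comp (u (k n)) e)
      (fun n => (integral_le_normPow 2 (comp (u (k n))) e).trans (hm (k n)))
      (fun n => (integral_le_normPow 2 (der (u (k n))) e).trans (hd (k n)))
    refine ⟨k ∘ l, hk.comp hl, fun e' he' => ?_⟩
    rcases Finset.mem_insert.1 he' with rfl | he'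
    · exact ⟨h, hh, hpt, hw⟩
    · obtain ⟨h', hh', hpt', hw'⟩ := hks e' he'
      exact ⟨h', hh', fun x hx => (hpt' x hx).comp hl.tendsto_atTop,
        fun ψ hψ => (hw' ψ hψ).comp hl.tendsto_atTop⟩

/-- Bounded sequences in `H¹(Γ)` have subsequences which converge pointwise to an element of
`H¹(Γ)`, along which mass, kinetic energy and quartic term split. -/
theorem exists_weak_limit {u : ℕ → H1 N} {C : ℝ} (hm : ∀ n, mass (u n) ≤ C)
    (hd : ∀ n, kinetic (u n) ≤ C) :
    ∃ φ : H1 N, ∃ k : ℕ → ℕ, StrictMono k ∧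
      (∀ e x, 0 ≤ x → Tendsto (fun j => comp (u (k j)) e x) atTop (𝓝 (comp φ e x))) ∧
      Tendsto (fun j => mass (u (k j)) - mass (u (k j) - φ)) atTop (𝓝 (mass φ)) ∧
      Tendsto (fun j => kinetic (u (k j)) - kinetic (u (k j) - φ)) atTop (𝓝 (kinetic φ)) ∧
      Tendsto (fun j => normPow 4 (comp (u (k j))) - normPow 4 (comp (u (k j) - φ))) atTop
        (𝓝 (normPow 4 (comp φ))) := by
  obtain ⟨k, hk, hks⟩ := exists_weak_subseq_edges hm hd Finset.univ
  choose h hh hpt hw using fun e => hks e (Finset.mem_univ e)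
  let φ : H1 N := ⟨h, by
    refine ⟨fun e e' => ?_, hh⟩
    have h1 := hpt e 0 le_rfl
    have h2 := hpt e' 0 le_rfl
    have : ∀ j, comp (u (k j)) e 0 = comp (u (k j)) e' 0 := fun j => by
      simpa [comp, onLine] using (u (k j)).2.1 e e'
    have := tendsto_nhds_unique (h1.congr this) h2
    simpa [onLine] using this⟩
  have hpt' : ∀ e x, 0 ≤ x → Tendsto (fun j => comp (u (k j)) e x) atTop (𝓝 (comp φ e x)) := hpt
  have hae : ∀ e, ∀ᵐ t ∂(volume.restrict (Ioi (0 : ℝ))),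
      Tendsto (fun j => comp (u (k j)) e t) atTop (𝓝 (comp φ e t)) := fun e => by
    filter_upwards [ae_restrict_mem measurableSet_Ioi] with t ht
    exact hpt' e t (le_of_lt ht)
  have hCr : ∀ n, mass (u n - φ) ≤ 2 * C + 2 * mass φ := fun n => by
    linarith [mass_sub_le (u n) φ, hm n]
  have hDr : ∀ n, kinetic (u n - φ) ≤ 2 * C + 2 * kinetic φ := fun n => by
    linarith [kinetic_sub_le (u n) φ, hd n]
  have hCe : ∀ e n, ∫ t in Ioi (0 : ℝ), ‖comp (u (k n)) e t - comp φ e t‖ ^ 2 ≤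
      2 * C + 2 * mass φ := fun e n =>
    (integral_le_normPow 2 (comp (u (k n) - φ)) e).trans (hCr _)
  refine ⟨φ, k, hk, hpt', ?_, ?_, ?_⟩
  · simp only [mass, normPow, ← Finset.sum_sub_distrib]
    refine tendsto_finsetSum _ fun e _ => ?_
    exact tendsto_integral_pow_sub (K := 2) (fun n => (memH1_comp _ e).1) (memH1_comp φ e).1
      (hCe e) (hae e) (fun n => integrable_norm_sq (memH1_comp _ e).1)
      (integrable_norm_sq (memH1_comp _ e).1)
      (fun n => integrable_norm_sq (memH1_comp (u (k n) - φ) e).1)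
      (fun n => Eventually.of_forall fun t => abs_sq_sub_sq_sub_sq_le _ _)
  · simp only [kinetic, normPow, ← Finset.sum_sub_distrib]
    refine tendsto_finsetSum _ fun e _ => ?_
    refine (tendsto_integral_sq_sub_of_weak (fun n => memLp_der (u (k n)) e) (memLp_der φ e)
      (hw e)).congr fun n => ?_
    congr 1
    apply integral_congr_ae
    filter_upwards [der_sub_ae (u (k n)) φ e] with t ht
    rw [ht, Pi.sub_apply]
  · simp only [normPow, ← Finset.sum_sub_distrib]
    refine tendsto_finsetSum _ fun e _ => ?_
    refine tendsto_integral_pow_sub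
      -- The factor 7 of the pointwise inequality times sup bounds for φ and for the remainders,
      -- uniform in n.
      (K := 7 * (2 * (√(mass φ) * √(kinetic φ)) +
        2 * (√(2 * C + 2 * mass φ) * √(2 * C + 2 * kinetic φ))))
      (fun n => (memH1_comp _ e).1) (memH1_comp φ e).1
      (hCe e) (hae e) (fun n => integrable_norm_pow_four _ e)
      (integrable_norm_pow_four φ e) (fun n => integrable_norm_pow_four (u (k n) - φ) e)
      (fun n => ?_)
    filter_upwards [ae_restrict_mem measurableSet_Ioi] with t ht
    refine (abs_pow_four_sub_sub_le _ _).trans (mul_le_mul_of_nonneg_right ?_ (by positivity))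
    have h1 := norm_sq_comp_le φ e (le_of_lt ht)
    have h2 := norm_sq_comp_le (u (k n) - φ) e (le_of_lt ht)
    have h3 : √(mass (u (k n) - φ)) * √(kinetic (u (k n) - φ)) ≤
        √(2 * C + 2 * mass φ) * √(2 * C + 2 * kinetic φ) :=
      mul_le_mul (Real.sqrt_le_sqrt (hCr _)) (Real.sqrt_le_sqrt (hDr _)) (by positivity)
        (by positivity)
    rw [comp_sub] at h2
    change 7 * (‖comp φ e t‖ ^ 2 + ‖comp (u (k n)) e t - comp φ e t‖ ^ 2) ≤ _
    linarith

end Splitting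

/-! ### The scalar minimization problem at small mass -/

section Scalar

variable {N : ℕ} [NeZero N] {γ : ℝ}

theorem scalarEnergy_ge (hγ : 0 ≤ γ) (u : H1 N) :
    kinetic u - (2 * γ + mass u) * (√(mass u) * √(kinetic u)) ≤ scalarEnergy γ u := by
  have h1 := norm_sq_comp_le u 0 le_rfl
  have h2 := normPow_four_le u (fun e x hx => norm_sq_comp_le u e hx)
  have h3 := mul_le_mul_of_nonneg_left h1 hγ
  unfold scalarEnergy
  linarith

/-- Coercivity: the negative terms are linear in √(kinetic u) and are absorbed by completing a
square. -/
theorem kinetic_le (hγ : 0 ≤ γ) (u : H1 N) :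
    kinetic u ≤ 2 * scalarEnergy γ u + (2 * γ + mass u) ^ 2 * mass u := by
  have h1 := scalarEnergy_ge hγ u
  have h2 := Real.sq_sqrt (mass_nonneg u)
  have h3 := Real.sq_sqrt (kinetic_nonneg u)
  nlinarith [sq_nonneg (√(kinetic u) - (2 * γ + mass u) * √(mass u))]

/-- The infimum of the scalar energy at mass `m`. -/
def scalarJ (N : ℕ) [NeZero N] (γ m : ℝ) : ℝ :=
  sInf (scalarEnergy γ '' {u : H1 N | mass u = m})

/-- Needed for `scalarJ` to be a true infimum: a real `sInf` is 0 on a set unbounded below. -/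
theorem bddBelow_scalarEnergy (hγ : 0 ≤ γ) (m : ℝ) :
    BddBelow (scalarEnergy γ '' {u : H1 N | mass u = m}) := by
  refine ⟨-((2 * γ + m) ^ 2 * m) / 2, ?_⟩
  rintro _ ⟨u, rfl, rfl⟩
  linarith [kinetic_le hγ u, kinetic_nonneg u]

theorem scalarJ_le (hγ : 0 ≤ γ) (u : H1 N) : scalarJ N γ (mass u) ≤ scalarEnergy γ u :=
  csInf_le (bddBelow_scalarEnergy hγ _) ⟨u, rfl, rfl⟩

/-- The function equal to `A exp (-κ x)` on every edge. -/
def expStar (N : ℕ) (A : ℝ) {κ : ℝ} (hκ : 0 < κ) : H1 N :=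
  ⟨fun _ => expEdge A κ, fun _ _ => rfl, fun _ => memH1_expEdge A hκ⟩

/-- The trial function has decay rate γ/N, that of the linear bound state, whose kinetic and vertex
terms add up to -m(γ/N)². Since Nm ≤ 4γ, this is already at most -m³/16, and the quartic term makes
the inequality strict. -/
theorem exists_scalarEnergy_lt (hγ : 0 < γ) {m : ℝ} (hm : 0 < m) (hmγ : N * m ≤ 4 * γ) :
    ∃ u : H1 N, mass u = m ∧ scalarEnergy γ u < -(m ^ 3 / 16) := by
  have hN : (0 : ℝ) < N := by exact_mod_cast Nat.pos_of_ne_zero (NeZero.ne N)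
  have hκ : 0 < γ / N := by positivity
  -- Normalization: N A²/(2κ) = m with κ = γ/N.
  set A : ℝ := √(2 * γ * m) / N with hA
  have hA0 : 0 ≤ A := by positivity
  have hA2 : A ^ 2 = 2 * γ * m / N ^ 2 := by
    rw [hA, div_pow, Real.sq_sqrt (by positivity)]
  have hA4 : A ^ 4 = (2 * γ * m / N ^ 2) ^ 2 := by
    rw [← hA2]; ring
  have hc : ∀ e, comp (expStar N A hκ) e = onLine (expEdge A (γ / N)) := fun _ => rfl
  have hd : ∀ e, der (expStar N A hκ) e = weakDeriv (onLine (expEdge A (γ / N))) := fun _ => rfl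
  have h1 : mass (expStar N A hκ) = m := by
    simp only [mass, normPow, hc, integral_norm_expEdge_pow hA0 hκ two_ne_zero, Finset.sum_const,
      Finset.card_univ, Fintype.card_fin, nsmul_eq_mul]
    rw [hA2]
    push_cast
    field_simp
  refine ⟨expStar N A hκ, h1, ?_⟩
  have h2 : kinetic (expStar N A hκ) = γ ^ 2 * m / N ^ 2 := by
    simp only [kinetic, normPow, hd, integral_norm_weakDeriv_expEdge_sq A hκ, Finset.sum_const,
      Finset.card_univ, Fintype.card_fin, nsmul_eq_mul]
    rw [hA2]
    field_simp
  have h3 : normPow 4 (comp (expStar N A hκ)) = γ * m ^ 2 / N ^ 2 := by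
    simp only [normPow, hc, integral_norm_expEdge_pow hA0 hκ four_ne_zero, Finset.sum_const,
      Finset.card_univ, Fintype.card_fin, nsmul_eq_mul]
    rw [hA4]
    push_cast
    field_simp
    norm_num
  have h4 : ‖comp (expStar N A hκ) 0 0‖ ^ 2 = 2 * γ * m / N ^ 2 := by
    rw [hc, onLine_expEdge A _ le_rfl, ← hA2, Complex.norm_real, Real.norm_eq_abs, sq_abs]
    simp
  rw [scalarEnergy, h2, h3, h4]
  have e : γ ^ 2 * m / N ^ 2 - γ * (2 * γ * m / N ^ 2) - 1 / 2 * (γ * m ^ 2 / N ^ 2) =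
      -(m * (γ / N) ^ 2) - 1 / 2 * (γ * m ^ 2 / N ^ 2) := by
    field_simp
    ring
  rw [e]
  have h5 : m / 4 ≤ γ / N := by
    rw [le_div_iff₀ hN]
    linarith
  have h6 : (m / 4) ^ 2 ≤ (γ / N) ^ 2 := by gcongr
  have h7 : 0 < γ * m ^ 2 / N ^ 2 := by positivity
  nlinarith [mul_le_mul_of_nonneg_left h6 hm.le]

/-- Sublinearity of the energy with respect to the mass. -/
theorem mul_scalarJ_le (hγ : 0 ≤ γ) {m : ℝ} (hm : 0 < m) (u : H1 N) (hu : mass u ≤ m) :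
    mass u * scalarJ N γ m ≤ m * scalarEnergy γ u := by
  -- At mass zero no rescaling reaches mass m; there the energy is nonnegative.
  rcases (mass_nonneg u).eq_or_lt with h0 | h0
  · have h1 := scalarEnergy_ge hγ u
    rw [← h0] at h1 ⊢
    simp only [Real.sqrt_zero, zero_mul, mul_zero, sub_zero] at h1 ⊢
    exact mul_nonneg hm.le ((kinetic_nonneg u).trans h1)
  · set s : ℝ := m / mass u with hs
    have hs1 : 1 ≤ s := by rwa [hs, one_le_div h0]
    have hs0 : 0 ≤ s := zero_le_one.trans hs1
    have hn : ‖((√s : ℝ) : ℂ)‖ ^ 2 = s := by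
      rw [Complex.norm_real, Real.norm_eq_abs, sq_abs, Real.sq_sqrt hs0]
    have hmass : mass (((√s : ℝ) : ℂ) • u) = m := by
      rw [mass_smul, hn, hs, div_mul_cancel₀ _ h0.ne']
    have hJ := scalarJ_le hγ (((√s : ℝ) : ℂ) • u)
    have hn4 : ‖((√s : ℝ) : ℂ)‖ ^ 4 = s ^ 2 := by
      rw [show (4 : ℕ) = 2 * 2 from rfl, pow_mul, hn]
    rw [hmass, scalarEnergy, kinetic_smul, normPow_comp_smul, comp_smul, norm_mul, mul_pow, hn,
      hn4] at hJ
    have hF := normPow_nonneg 4 (comp u)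
    -- Rescaling by √s multiplies the quadratic terms by s and the quartic one by s² ≥ s, which only
    -- lowers the energy.
    have h2 : scalarJ N γ m ≤ s * scalarEnergy γ u := by
      unfold scalarEnergy
      nlinarith [mul_nonneg (mul_nonneg hs0 (sub_nonneg.2 hs1)) hF]
    have h3 := mul_le_mul_of_nonneg_left h2 h0.le
    have h4 : mass u * (s * scalarEnergy γ u) = m * scalarEnergy γ u := by
      rw [hs]; field_simp
    linarith

theorem normPow_four_le_vertex (u : H1 N) :
    normPow 4 (comp u) ≤
      (1 / 2 * ‖comp u 0 0‖ ^ 2 + √(mass u) * √(kinetic u)) * mass u :=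
  normPow_four_le u fun e _ hx => norm_sq_comp_le_vertex u e hx

/-- Lower bound for the energy of functions which are small at the vertex. -/
theorem scalarEnergy_ge_vertex (u : H1 N) :
    -(mass u ^ 3 / 16) - (γ + mass u / 4) * ‖comp u 0 0‖ ^ 2 ≤ scalarEnergy γ u := by
  have h1 := normPow_four_le_vertex u
  have h2 := Real.sq_sqrt (mass_nonneg u)
  have h3 := Real.sq_sqrt (kinetic_nonneg u)
  have h4 : (√(mass u) * mass u / 4) ^ 2 = mass u ^ 3 / 16 := by
    rw [div_pow, mul_pow, h2]; ring
  unfold scalarEnergy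
  -- Completing the square in K - ½ μ^(3/2) √K, with K the kinetic energy and μ the mass, loses
  -- exactly μ³/16.
  nlinarith [sq_nonneg (√(kinetic u) - √(mass u) * mass u / 4)]

/-- Minimizing sequences of the scalar problem with small mass are relatively compact. -/
theorem scalar_relatively_compact (hγ : 0 < γ) {m : ℝ} (hm : 0 < m) (hmγ : N * m ≤ 4 * γ)
    {u : ℕ → H1 N} (hu : ∀ n, mass (u n) = m)
    (hE : Tendsto (fun n => scalarEnergy γ (u n)) atTop (𝓝 (scalarJ N γ m))) :
    ∃ φ : H1 N, ∃ k : ℕ → ℕ, StrictMono k ∧ mass φ = m ∧ scalarEnergy γ φ = scalarJ N γ m ∧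
      (∀ e x, 0 ≤ x → Tendsto (fun j => comp (u (k j)) e x) atTop (𝓝 (comp φ e x))) ∧
      Tendsto (fun j => mass (u (k j) - φ)) atTop (𝓝 0) ∧
      Tendsto (fun j => kinetic (u (k j) - φ)) atTop (𝓝 0) := by
  obtain ⟨B, hB⟩ := hE.bddAbove_range
  set C : ℝ := max m (2 * B + (2 * γ + m) ^ 2 * m) with hC
  have hmC : ∀ n, mass (u n) ≤ C := fun n => by rw [hu n]; exact le_max_left _ _
  have hdC : ∀ n, kinetic (u n) ≤ C := fun n => by
    refine le_trans ?_ (le_max_right _ _)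
    have h1 := kinetic_le hγ.le (u n)
    have h2 := hB (mem_range_self n)
    rw [hu n] at h1
    linarith
  obtain ⟨φ, k, hk, hpt, hM, hD, hF⟩ := exists_weak_limit hmC hdC
  set r : ℕ → H1 N := fun j => u (k j) - φ with hr
  have hM' : Tendsto (fun j => mass (r j)) atTop (𝓝 (m - mass φ)) := by
    refine (hM.const_sub m).congr fun j => ?_
    rw [hu]
    ring
  -- Convergence at the vertex makes the remainder vanish there, so the vertex bound applies to it
  -- with no loss in the limit.
  have hv : Tendsto (fun j => ‖comp (r j) 0 0‖ ^ 2) atTop (𝓝 0) := by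
    have := (((hpt 0 0 le_rfl).sub_const (comp φ 0 0)).norm).pow 2
    rw [sub_self, norm_zero, zero_pow two_ne_zero] at this
    exact this
  have hEr : Tendsto (fun j => scalarEnergy γ (r j)) atTop
      (𝓝 (scalarJ N γ m - scalarEnergy γ φ)) := by
    have h1 := (((hpt 0 0 le_rfl).norm.pow 2).sub hv).const_mul γ
    have h2 := (hD.sub h1).sub (hF.const_mul (1 / 2))
    rw [sub_zero] at h2
    refine ((hE.comp hk.tendsto_atTop).sub h2).congr fun j => ?_
    simp only [Function.comp_apply, scalarEnergy, hr]
    ring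
  have hmφ : mass φ ≤ m := by
    have := ge_of_tendsto' hM' fun j => mass_nonneg _
    linarith
  have hJ : scalarJ N γ m < -(m ^ 3 / 16) := by
    obtain ⟨w, hw, hlt⟩ := exists_scalarEnergy_lt (N := N) hγ hm hmγ
    have := scalarJ_le hγ.le w
    rw [hw] at this
    exact this.trans_lt hlt
  have hlow : -((m - mass φ) ^ 3 / 16) ≤ scalarJ N γ m - scalarEnergy γ φ := by
    have h1 := (((hM'.pow 3).div_const 16).neg).sub (((hM'.div_const 4).const_add γ).mul hv)
    rw [mul_zero, sub_zero] at h1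
    exact le_of_tendsto_of_tendsto' h1 hEr fun j => scalarEnergy_ge_vertex _
  have hφm : mass φ = m := by
    by_contra hne
    have hlt : mass φ < m := lt_of_le_of_ne hmφ hne
    have h1 := mul_scalarJ_le hγ.le hm φ hmφ
    have hd : 0 < m - mass φ := sub_pos.2 hlt
    -- Sublinearity turns `hlow` into an inequality with the common factor m - mass φ, which is
    -- positive and can be cancelled.
    have h2 : -(m * (m - mass φ) ^ 2 / 16) ≤ scalarJ N γ m := by
      have h3 : (m - mass φ) * -(m * (m - mass φ) ^ 2 / 16) ≤ (m - mass φ) * scalarJ N γ m := by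
        nlinarith [mul_le_mul_of_nonneg_left hlow hm.le]
      exact le_of_mul_le_mul_left h3 hd
    have h4 : (m - mass φ) ^ 2 ≤ m ^ 2 := by
      have := mass_nonneg φ
      gcongr
      linarith
    nlinarith [mul_le_mul_of_nonneg_left h4 hm.le]
  rw [hφm, sub_self] at hM'
  have hEφ : scalarJ N γ m ≤ scalarEnergy γ φ := by
    have := scalarJ_le hγ.le φ
    rwa [hφm] at this
  have hEφ' : scalarEnergy γ φ = scalarJ N γ m := by
    rw [hφm] at hlow
    norm_num at hlow
    linarith
  refine ⟨φ, k, hk, hφm, hEφ', hpt, hM', ?_⟩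
  rw [hEφ', sub_self] at hEr
  set C' : ℝ := 2 * C + 2 * kinetic φ
  have hD' : ∀ j, kinetic (r j) ≤ C' := fun j => by
    linarith [kinetic_sub_le (u (k j)) φ, hdC (k j)]
  -- The kinetic energy of the remainder is its energy plus vertex and quartic terms; all three
  -- vanish, the quartic one because the mass does.
  have hup : Tendsto (fun j => scalarEnergy γ (r j) + γ * ‖comp (r j) 0 0‖ ^ 2 +
      1 / 2 * ((1 / 2 * ‖comp (r j) 0 0‖ ^ 2 + √(mass (r j)) * √C') * mass (r j))) atTop
      (𝓝 0) := by
    have h1 := ((hv.const_mul (1 / 2)).add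
      (((Real.continuous_sqrt.tendsto _).comp hM').mul_const √C')).mul hM'
    have h2 := (hEr.add (hv.const_mul γ)).add (h1.const_mul (1 / 2))
    simpa using h2
  refine squeeze_zero (fun j => kinetic_nonneg _) (fun j => ?_) hup
  have h1 := normPow_four_le_vertex (r j)
  have h2 : √(mass (r j)) * √(kinetic (r j)) ≤ √(mass (r j)) * √C' :=
    mul_le_mul_of_nonneg_left (Real.sqrt_le_sqrt (hD' j)) (by positivity)
  have h3 := mul_le_mul_of_nonneg_right h2 (mass_nonneg (r j))
  have h4 : scalarEnergy γ (r j) = kinetic (r j) - γ * ‖comp (r j) 0 0‖ ^ 2 -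
    1 / 2 * normPow 4 (comp (r j)) := rfl
  change kinetic (r j) ≤ _
  nlinarith

end Scalar

/-! ### The coupling remainder ∫ (|u|² - |v|²)² -/

section ModulusGap

variable {N : ℕ}

/-- The integral `∫ (|u|² - |v|²)²` over the graph. -/
def modulusGap (u v : H1 N) : ℝ :=
  ∑ e : Fin N, ∫ x in Ioi (0 : ℝ), (‖comp u e x‖ ^ 2 - ‖comp v e x‖ ^ 2) ^ 2

theorem modulusGap_nonneg (u v : H1 N) : 0 ≤ modulusGap u v :=
  Finset.sum_nonneg fun _ _ => integral_nonneg fun _ => sq_nonneg _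

theorem modulusGap_self (u : H1 N) : modulusGap u u = 0 := by
  simp [modulusGap]

theorem sq_sub_norm_sq_eq (u v : H1 N) (e : Fin N) (x : ℝ) :
    (‖comp u e x‖ ^ 2 - ‖comp v e x‖ ^ 2) ^ 2 =
      ‖comp u e x‖ ^ 4 + ‖comp v e x‖ ^ 4 - 2 * (‖comp u e x‖ ^ 2 * ‖comp v e x‖ ^ 2) := by
  ring

theorem integrable_sq_sub_norm_sq (u v : H1 N) (e : Fin N) :
    Integrable (fun x => (‖comp u e x‖ ^ 2 - ‖comp v e x‖ ^ 2) ^ 2) (volume.restrict (Ioi 0)) := by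
  simp only [sq_sub_norm_sq_eq]
  exact ((integrable_norm_pow_four u e).add (integrable_norm_pow_four v e)).sub
    ((integrable_norm_sq_mul_norm_sq u v e).const_mul 2)

theorem modulusGap_eq (u v : H1 N) :
    modulusGap u v = normPow 4 (comp u) + normPow 4 (comp v) -
      2 * normPow 2 (fun e x => comp u e x * comp v e x) := by
  simp only [modulusGap, normPow, Finset.mul_sum, ← Finset.sum_add_distrib,
    ← Finset.sum_sub_distrib, sq_sub_norm_sq_eq, norm_mul, mul_pow]
  refine Finset.sum_congr rfl fun e _ => ?_
  have h1 : Integrable (fun x => ‖comp u e x‖ ^ 4 + ‖comp v e x‖ ^ 4)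
      (volume.restrict (Ioi 0)) :=
    (integrable_norm_pow_four u e).add (integrable_norm_pow_four v e)
  rw [integral_sub h1 ((integrable_norm_sq_mul_norm_sq u v e).const_mul 2),
    integral_add (integrable_norm_pow_four u e) (integrable_norm_pow_four v e),
    integral_const_mul]

/-- A consequence of Fatou's lemma. -/
theorem integral_eq_zero_of_tendsto {α : Type*} [MeasurableSpace α] {ν : Measure α}
    {f : ℕ → α → ℝ} {g : α → ℝ} (hf : ∀ n, Integrable (f n) ν) (hg : Integrable g ν)
    (hf0 : ∀ n x, 0 ≤ f n x) (hg0 : ∀ x, 0 ≤ g x)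
    (hlim : ∀ᵐ x ∂ν, Tendsto (fun n => f n x) atTop (𝓝 (g x)))
    (hint : Tendsto (fun n => ∫ x, f n x ∂ν) atTop (𝓝 0)) : ∫ x, g x ∂ν = 0 := by
  rw [integral_eq_lintegral_of_nonneg_ae (Eventually.of_forall hg0) hg.1]
  have h1 : ∫⁻ x, ENNReal.ofReal (g x) ∂ν ≤
      liminf (fun n => ∫⁻ x, ENNReal.ofReal (f n x) ∂ν) atTop := by
    refine le_trans (le_of_eq (lintegral_congr_ae ?_))
      (lintegral_liminf_le' fun n => (hf n).1.aemeasurable.ennreal_ofReal)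
    filter_upwards [hlim] with x hx
    exact ((ENNReal.continuous_ofReal.tendsto _).comp hx).liminf_eq.symm
  have h2 : Tendsto (fun n => ∫⁻ x, ENNReal.ofReal (f n x) ∂ν) atTop (𝓝 0) := by
    have := (ENNReal.continuous_ofReal.tendsto _).comp hint
    rw [ENNReal.ofReal_zero] at this
    exact this.congr fun n =>
      ofReal_integral_eq_lintegral_ofReal (hf n) (Eventually.of_forall (hf0 n))
  rw [h2.liminf_eq] at h1
  rw [le_antisymm h1 zero_le, ENNReal.toReal_zero]

/-- Fatou on each edge. It ensures that the limiting pair pays no coupling cost. -/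
theorem modulusGap_eq_zero_of_tendsto {u v : ℕ → H1 N} {φ ψ : H1 N}
    (hu : ∀ e x, 0 ≤ x → Tendsto (fun j => comp (u j) e x) atTop (𝓝 (comp φ e x)))
    (hv : ∀ e x, 0 ≤ x → Tendsto (fun j => comp (v j) e x) atTop (𝓝 (comp ψ e x)))
    (h : Tendsto (fun j => modulusGap (u j) (v j)) atTop (𝓝 0)) : modulusGap φ ψ = 0 := by
  refine Finset.sum_eq_zero fun e _ => ?_
  refine integral_eq_zero_of_tendsto (fun j => integrable_sq_sub_norm_sq (u j) (v j) e)
    (integrable_sq_sub_norm_sq φ ψ e) (fun _ _ => sq_nonneg _) (fun _ => sq_nonneg _) ?_ ?_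
  · filter_upwards [ae_restrict_mem measurableSet_Ioi] with x hx
    exact (((hu e x (le_of_lt hx)).norm.pow 2).sub ((hv e x (le_of_lt hx)).norm.pow 2)).pow 2
  · refine squeeze_zero (fun j => integral_nonneg fun x => sq_nonneg _) (fun j => ?_) h
    exact Finset.single_le_sum
      (f := fun e => ∫ x in Ioi (0 : ℝ), (‖comp (u j) e x‖ ^ 2 - ‖comp (v j) e x‖ ^ 2) ^ 2)
      (fun _ _ => integral_nonneg fun _ => sq_nonneg _) (Finset.mem_univ e)

end ModulusGap

/-! ### Decoupling the system and returning to pairs -/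

section Pair

variable {N : ℕ}

/-- The pair `(√ρ u, √σ v)`. -/
def scaledPair (ρ σ : ℝ) (u v : H1 N) : X N := (((√ρ : ℝ) : ℂ) • u, ((√σ : ℝ) : ℂ) • v)

theorem norm_ofReal_sqrt_sq {ρ : ℝ} (hρ : 0 ≤ ρ) : ‖((√ρ : ℝ) : ℂ)‖ ^ 2 = ρ := by
  rw [Complex.norm_real, Real.norm_eq_abs, sq_abs, Real.sq_sqrt hρ]

theorem exists_eq_scaledPair {ρ σ : ℝ} (hρ : 0 < ρ) (hσ : 0 < σ) (w : X N) :
    ∃ u v : H1 N, w = scaledPair ρ σ u v := by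
  have h1 : ((√ρ : ℝ) : ℂ) ≠ 0 := by exact_mod_cast (Real.sqrt_pos.2 hρ).ne'
  have h2 : ((√σ : ℝ) : ℂ) ≠ 0 := by exact_mod_cast (Real.sqrt_pos.2 hσ).ne'
  exact ⟨((√ρ : ℝ) : ℂ)⁻¹ • w.1, ((√σ : ℝ) : ℂ)⁻¹ • w.2,
    Prod.ext (smul_inv_smul₀ h1 _).symm (smul_inv_smul₀ h2 _).symm⟩

theorem scaledPair_mem_constraint {ρ σ m : ℝ} (hρ : 0 < ρ) (hσ : 0 < σ) (u v : H1 N) :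
    scaledPair ρ σ u v ∈ constraint N (ρ * m) (σ * m) ↔ mass u = m ∧ mass v = m := by
  simp only [constraint, mem_ofPred_eq, scaledPair, mass_smul, norm_ofReal_sqrt_sq hρ.le,
    norm_ofReal_sqrt_sq hσ.le, mul_right_inj' hρ.ne', mul_right_inj' hσ.ne']

theorem scaledPair_sub (ρ σ : ℝ) (u v φ ψ : H1 N) :
    scaledPair ρ σ u v - scaledPair ρ σ φ ψ = scaledPair ρ σ (u - φ) (v - ψ) :=
  Prod.ext (smul_sub ((√ρ : ℝ) : ℂ) u φ).symm (smul_sub ((√σ : ℝ) : ℂ) v ψ).symm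

theorem normX_scaledPair {ρ σ : ℝ} (hρ : 0 ≤ ρ) (hσ : 0 ≤ σ) (u v : H1 N) :
    normX (scaledPair ρ σ u v) =
      √((ρ * mass u + ρ * kinetic u) + (σ * mass v + σ * kinetic v)) := by
  change √((mass (((√ρ : ℝ) : ℂ) • u) + kinetic (((√ρ : ℝ) : ℂ) • u)) +
    (mass (((√σ : ℝ) : ℂ) • v) + kinetic (((√σ : ℝ) : ℂ) • v))) = _
  rw [mass_smul, mass_smul, kinetic_smul, kinetic_smul, norm_ofReal_sqrt_sq hρ,
    norm_ofReal_sqrt_sq hσ]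

variable [NeZero N] {a b c γ ρ σ : ℝ}

/-- The energy of a pair decouples into two scalar energies and a nonnegative remainder. -/
theorem energy_scaledPair (hρ : 0 ≤ ρ) (hσ : 0 ≤ σ) (h1 : a * ρ + b * σ = 1)
    (h2 : b * ρ + c * σ = 1) (u v : H1 N) :
    energy a b c γ (scaledPair ρ σ u v) = ρ * scalarEnergy γ u + σ * scalarEnergy γ v +
      b * ρ * σ / 2 * modulusGap u v := by
  have e1 := norm_ofReal_sqrt_sq hρ
  have e2 := norm_ofReal_sqrt_sq hσ
  have e3 : ‖((√ρ : ℝ) : ℂ)‖ ^ 4 = ρ ^ 2 := by rw [show (4 : ℕ) = 2 * 2 from rfl, pow_mul, e1]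
  have e4 : ‖((√σ : ℝ) : ℂ)‖ ^ 4 = σ ^ 2 := by rw [show (4 : ℕ) = 2 * 2 from rfl, pow_mul, e2]
  have e5 : normPow 2 (fun e x => comp (((√ρ : ℝ) : ℂ) • u) e x *
      comp (((√σ : ℝ) : ℂ) • v) e x) =
      ρ * σ * normPow 2 (fun e x => comp u e x * comp v e x) := by
    simp only [normPow, Finset.mul_sum, ← integral_const_mul]
    refine Finset.sum_congr rfl fun e _ => ?_
    congr 1
    funext x
    rw [comp_smul, comp_smul, norm_mul, norm_mul, norm_mul, norm_mul, mul_pow, mul_pow, mul_pow,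
      mul_pow, e1, e2]
    ring
  have e6 : energy a b c γ (scaledPair ρ σ u v) =
      kinetic (((√ρ : ℝ) : ℂ) • u) + kinetic (((√σ : ℝ) : ℂ) • v)
      - γ * (‖comp (((√ρ : ℝ) : ℂ) • u) 0 0‖ ^ 2 + ‖comp (((√σ : ℝ) : ℂ) • v) 0 0‖ ^ 2)
      - 1 / 2 * (a * normPow 4 (comp (((√ρ : ℝ) : ℂ) • u)) +
        c * normPow 4 (comp (((√σ : ℝ) : ℂ) • v)))
      - b * normPow 2 (fun e x => comp (((√ρ : ℝ) : ℂ) • u) e x *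
        comp (((√σ : ℝ) : ℂ) • v) e x) := rfl
  rw [e6, e5, modulusGap_eq, kinetic_smul, kinetic_smul, normPow_comp_smul, normPow_comp_smul,
    comp_smul, comp_smul, norm_mul, norm_mul, mul_pow, mul_pow, e1, e2, e3, e4]
  unfold scalarEnergy
  have h3 : a * ρ = 1 - b * σ := by linarith
  have h4 : c * σ = 1 - b * ρ := by linarith
  -- Here aρ² = ρ - bρσ and cσ² = σ - bρσ; the surplus bρσ combines with the coupling term into a
  -- perfect square.
  linear_combination (-(1 / 2) * ρ * normPow 4 (comp u)) * h3 -
    (1 / 2 * σ * normPow 4 (comp v)) * h4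

variable {m : ℝ}

theorem energy_ge (hb : 0 < b) (hγ : 0 ≤ γ) (hρ : 0 < ρ) (hσ : 0 < σ) (h1 : a * ρ + b * σ = 1)
    (h2 : b * ρ + c * σ = 1) {w : X N} (hw : w ∈ constraint N (ρ * m) (σ * m)) :
    (ρ + σ) * scalarJ N γ m ≤ energy a b c γ w := by
  obtain ⟨u, v, rfl⟩ := exists_eq_scaledPair hρ hσ w
  obtain ⟨hu, hv⟩ := (scaledPair_mem_constraint hρ hσ u v).1 hw
  rw [energy_scaledPair hρ.le hσ.le h1 h2]
  have hJu := scalarJ_le hγ u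
  have hJv := scalarJ_le hγ v
  rw [hu] at hJu
  rw [hv] at hJv
  have h3 : 0 ≤ b * ρ * σ / 2 * modulusGap u v :=
    mul_nonneg (by positivity) (modulusGap_nonneg u v)
  nlinarith

theorem bddBelow_energy (hb : 0 < b) (hγ : 0 ≤ γ) (hρ : 0 < ρ) (hσ : 0 < σ)
    (h1 : a * ρ + b * σ = 1) (h2 : b * ρ + c * σ = 1) :
    BddBelow (energy a b c γ '' constraint N (ρ * m) (σ * m)) := by
  refine ⟨(ρ + σ) * scalarJ N γ m, ?_⟩
  rintro _ ⟨w, hw, rfl⟩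
  exact energy_ge hb hγ hρ hσ h1 h2 hw

theorem constraint_nonempty (hγ : 0 < γ) (hρ : 0 < ρ) (hσ : 0 < σ) (hm : 0 < m)
    (hmγ : N * m ≤ 4 * γ) : (constraint N (ρ * m) (σ * m)).Nonempty := by
  obtain ⟨u, hu, -⟩ := exists_scalarEnergy_lt (N := N) hγ hm hmγ
  exact ⟨scaledPair ρ σ u u, (scaledPair_mem_constraint hρ hσ u u).2 ⟨hu, hu⟩⟩

/-- The lower bound drops the nonnegative gap; the upper bound uses diagonal pairs (u, u), where the
gap is zero. -/
theorem J_eq (hb : 0 < b) (hγ : 0 < γ) (hρ : 0 < ρ) (hσ : 0 < σ) (h1 : a * ρ + b * σ = 1)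
    (h2 : b * ρ + c * σ = 1) (hm : 0 < m) (hmγ : N * m ≤ 4 * γ) :
    J N a b c γ (ρ * m) (σ * m) = (ρ + σ) * scalarJ N γ m := by
  apply le_antisymm
  · rw [← div_le_iff₀' (by positivity)]
    obtain ⟨u₀, hu₀, -⟩ := exists_scalarEnergy_lt (N := N) hγ hm hmγ
    refine le_csInf ⟨_, u₀, hu₀, rfl⟩ ?_
    rintro _ ⟨u, hu, rfl⟩
    rw [div_le_iff₀' (by positivity)]
    refine (csInf_le (bddBelow_energy hb hγ.le hρ hσ h1 h2) ⟨scaledPair ρ σ u u,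
      (scaledPair_mem_constraint hρ hσ u u).2 ⟨hu, hu⟩, rfl⟩).trans (le_of_eq ?_)
    rw [energy_scaledPair hρ.le hσ.le h1 h2, modulusGap_self]
    ring
  · refine le_csInf ((constraint_nonempty hγ hρ hσ hm hmγ).image _) ?_
    rintro _ ⟨w, hw, rfl⟩
    exact energy_ge hb hγ.le hρ hσ h1 h2 hw

/-- Minimizing sequences have subsequences which converge to a minimizer. -/
theorem IsMinimizingSeq.exists_subseq_tendsto (hb : 0 < b) (hγ : 0 < γ) (hρ : 0 < ρ) (hσ : 0 < σ)
    (h1 : a * ρ + b * σ = 1) (h2 : b * ρ + c * σ = 1) (hm : 0 < m) (hmγ : N * m ≤ 4 * γ)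
    {w : ℕ → X N} (hw : IsMinimizingSeq a b c γ (ρ * m) (σ * m) w) :
    ∃ k : ℕ → ℕ, StrictMono k ∧ ∃ Φ ∈ minimizers N a b c γ (ρ * m) (σ * m),
      Tendsto (fun j => normX (w (k j) - Φ)) atTop (𝓝 0) := by
  obtain ⟨hcon, hE⟩ := hw
  choose u v huv using fun n => exists_eq_scaledPair hρ hσ (w n)
  have hmass : ∀ n, mass (u n) = m ∧ mass (v n) = m := fun n =>
    (scaledPair_mem_constraint hρ hσ _ _).1 (huv n ▸ hcon n)
  have hJ := J_eq (N := N) hb hγ hρ hσ h1 h2 hm hmγ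
  have hJu : ∀ n, scalarJ N γ m ≤ scalarEnergy γ (u n) := fun n => by
    have := scalarJ_le hγ.le (u n)
    rwa [(hmass n).1] at this
  have hJv : ∀ n, scalarJ N γ m ≤ scalarEnergy γ (v n) := fun n => by
    have := scalarJ_le hγ.le (v n)
    rwa [(hmass n).2] at this
  have hκ : 0 < b * ρ * σ / 2 := by positivity
  -- The excess energy is a sum of three nonnegative terms, so each of them tends to 0 separately.
  have hδ : Tendsto (fun n => ρ * (scalarEnergy γ (u n) - scalarJ N γ m) +
      σ * (scalarEnergy γ (v n) - scalarJ N γ m) +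
      b * ρ * σ / 2 * modulusGap (u n) (v n)) atTop (𝓝 0) := by
    have h3 := hE.sub_const (J N a b c γ (ρ * m) (σ * m))
    rw [sub_self] at h3
    refine h3.congr fun n => ?_
    rw [huv n, energy_scaledPair hρ.le hσ.le h1 h2, hJ]
    ring
  have hlim : ∀ {f : ℕ → ℝ} {t : ℝ}, 0 < t → (∀ n, 0 ≤ f n) →
      (∀ n, t * f n ≤ ρ * (scalarEnergy γ (u n) - scalarJ N γ m) +
        σ * (scalarEnergy γ (v n) - scalarJ N γ m) +
        b * ρ * σ / 2 * modulusGap (u n) (v n)) → Tendsto f atTop (𝓝 0) := by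
    intro f t ht hf0 hf
    have h3 := hδ.const_mul t⁻¹
    rw [mul_zero] at h3
    refine squeeze_zero hf0 (fun n => ?_) h3
    rw [← div_eq_inv_mul, le_div_iff₀' ht]
    exact hf n
  have p1 : ∀ n, 0 ≤ ρ * (scalarEnergy γ (u n) - scalarJ N γ m) := fun n =>
    mul_nonneg hρ.le (sub_nonneg.2 (hJu n))
  have p2 : ∀ n, 0 ≤ σ * (scalarEnergy γ (v n) - scalarJ N γ m) := fun n =>
    mul_nonneg hσ.le (sub_nonneg.2 (hJv n))
  have p3 : ∀ n, 0 ≤ b * ρ * σ / 2 * modulusGap (u n) (v n) := fun n =>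
    mul_nonneg hκ.le (modulusGap_nonneg _ _)
  have hu : Tendsto (fun n => scalarEnergy γ (u n)) atTop (𝓝 (scalarJ N γ m)) :=
    tendsto_sub_nhds_zero_iff.1 (hlim hρ (fun n => sub_nonneg.2 (hJu n)) fun n => by
      linarith [p2 n, p3 n])
  have hv : Tendsto (fun n => scalarEnergy γ (v n)) atTop (𝓝 (scalarJ N γ m)) :=
    tendsto_sub_nhds_zero_iff.1 (hlim hσ (fun n => sub_nonneg.2 (hJv n)) fun n => by
      linarith [p1 n, p3 n])
  have hgap : Tendsto (fun n => modulusGap (u n) (v n)) atTop (𝓝 0) :=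
    hlim hκ (fun n => modulusGap_nonneg _ _) fun n => by linarith [p1 n, p2 n]
  obtain ⟨φ, k, hk, hφm, hφE, hφpt, hφM, hφD⟩ :=
    scalar_relatively_compact hγ hm hmγ (fun n => (hmass n).1) hu
  -- The second component is extracted along the first subsequence, so that one subsequence serves
  -- both.
  obtain ⟨ψ, l, hl, hψm, hψE, hψpt, hψM, hψD⟩ :=
    scalar_relatively_compact hγ hm hmγ (u := fun j => v (k j)) (fun j => (hmass (k j)).2)
      (hv.comp hk.tendsto_atTop)
  have hgap0 : modulusGap φ ψ = 0 :=
    modulusGap_eq_zero_of_tendsto (fun e x hx => (hφpt e x hx).comp hl.tendsto_atTop) hψpt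
      (hgap.comp (hk.comp hl).tendsto_atTop)
  refine ⟨k ∘ l, hk.comp hl, scaledPair ρ σ φ ψ,
    ⟨?_, (scaledPair_mem_constraint hρ hσ φ ψ).2 ⟨hφm, hψm⟩⟩, ?_⟩
  · rw [energy_scaledPair hρ.le hσ.le h1 h2, hgap0, hφE, hψE, hJ]
    ring
  · have h3 := (((hφM.comp hl.tendsto_atTop).const_mul ρ).add
      ((hφD.comp hl.tendsto_atTop).const_mul ρ)).add
      ((hψM.const_mul σ).add (hψD.const_mul σ))
    have h4 := (Real.continuous_sqrt.tendsto _).comp h3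
    simp only [mul_zero, add_zero, Real.sqrt_zero] at h4
    refine h4.congr fun j => ?_
    rw [huv, scaledPair_sub, normX_scaledPair hρ.le hσ.le]
    rfl

theorem minimizers_nonempty (hb : 0 < b) (hγ : 0 < γ) (hρ : 0 < ρ) (hσ : 0 < σ)
    (h1 : a * ρ + b * σ = 1) (h2 : b * ρ + c * σ = 1) (hm : 0 < m) (hmγ : N * m ≤ 4 * γ) :
    (minimizers N a b c γ (ρ * m) (σ * m)).Nonempty := by
  obtain ⟨t, -, ht, hmem⟩ := exists_seq_tendsto_sInf
    ((constraint_nonempty hγ hρ hσ hm hmγ).image (energy a b c γ))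
    (bddBelow_energy hb hγ.le hρ hσ h1 h2)
  choose w hw hwt using hmem
  obtain ⟨-, -, Φ, hΦ, -⟩ := IsMinimizingSeq.exists_subseq_tendsto hb hγ hρ hσ h1 h2 hm hmγ
    (w := w) ⟨hw, ht.congr fun n => (hwt n).symm⟩
  exact ⟨Φ, hΦ⟩

/-- Every subsequence is again minimizing, hence has a further subsequence converging to some
minimizer. That minimizer bounds the distance; an infimum over an empty type would be 0, but
`minimizers_nonempty` excludes this. -/
theorem IsMinimizingSeq.tendsto_iInf_normX (hb : 0 < b) (hγ : 0 < γ) (hρ : 0 < ρ) (hσ : 0 < σ)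
    (h1 : a * ρ + b * σ = 1) (h2 : b * ρ + c * σ = 1) (hm : 0 < m) (hmγ : N * m ≤ 4 * γ)
    {w : ℕ → X N} (hw : IsMinimizingSeq a b c γ (ρ * m) (σ * m) w) :
    Tendsto (fun n => ⨅ Φ : minimizers N a b c γ (ρ * m) (σ * m), normX (w n - Φ.1)) atTop
      (𝓝 0) := by
  refine tendsto_of_subseq_tendsto fun l hl => ?_
  obtain ⟨k, -, Φ, hΦ, hlim⟩ := IsMinimizingSeq.exists_subseq_tendsto hb hγ hρ hσ h1 h2 hm hmγ
    (w := fun n => w (l n)) ⟨fun n => hw.1 _, hw.2.comp hl⟩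
  refine ⟨k, squeeze_zero (fun n => Real.iInf_nonneg fun Ψ => Real.sqrt_nonneg _) (fun n => ?_)
    hlim⟩
  exact ciInf_le (f := fun Ψ : minimizers N a b c γ (ρ * m) (σ * m) => normX (w (l (k n)) - Ψ.1))
    ⟨0, by rintro _ ⟨Ψ, rfl⟩; exact Real.sqrt_nonneg _⟩ ⟨Φ, hΦ⟩

end Pair

/-! ### The coefficients and the theorem -/

/-- Cramer's rule for the symmetric system with rows (a, b) and (b, c). In the first case numerators
and determinant are all negative, in the second all positive. -/
theorem exists_mass_coefficients {a b c : ℝ}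
    (habc : (0 < b ∧ b < min a c) ∨ ((0 < a ∧ 0 < c) ∧ max a c < b)) :
    0 < b ∧ 0 < (b - c) / (b ^ 2 - a * c) ∧ 0 < (b - a) / (b ^ 2 - a * c) ∧
      a * ((b - c) / (b ^ 2 - a * c)) + b * ((b - a) / (b ^ 2 - a * c)) = 1 ∧
      b * ((b - c) / (b ^ 2 - a * c)) + c * ((b - a) / (b ^ 2 - a * c)) = 1 := by
  rcases habc with ⟨hb, h⟩ | ⟨⟨ha, hc⟩, h⟩
  · obtain ⟨h1, h2⟩ := lt_min_iff.1 h
    have hd : b ^ 2 - a * c < 0 := by nlinarith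
    have hd0 := hd.ne
    refine ⟨hb, div_pos_of_neg_of_neg (by linarith) hd, div_pos_of_neg_of_neg (by linarith) hd,
      ?_, ?_⟩
    all_goals
      rw [← mul_div_assoc, ← mul_div_assoc, ← add_div, div_eq_one_iff_eq hd0]
      ring
  · obtain ⟨h1, h2⟩ := max_lt_iff.1 h
    have hd : 0 < b ^ 2 - a * c := by nlinarith
    have hd0 := hd.ne'
    refine ⟨by linarith, div_pos (by linarith) hd, div_pos (by linarith) hd, ?_, ?_⟩
    all_goals
      rw [← mul_div_assoc, ← mul_div_assoc, ← add_div, div_eq_one_iff_eq hd0]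
      ring

end StarGraph

end

open StarGraph in
theorem theorem1 (N : ℕ) [NeZero N] (hN : 2 ≤ N) (a b c γ ω α β : ℝ)
    (habc : (0 < b ∧ b < min a c) ∨ ((0 < a ∧ 0 < c) ∧ max a c < b))
    (hγ : 0 < γ) (hω : γ ^ 2 / (N : ℝ) ^ 2 < ω)
    (hωγ : N * √ω - γ ≤ 2 * γ / N)
    (hα : α = massA N a b c γ ω) (hβ : β = massB N a b c γ ω) :
    -- the infimum defining `J(α,β)` is finite
    BddBelow (energy a b c γ '' constraint N α β) ∧
    -- every minimizing sequence is relatively compact in `X`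
    (∀ w : ℕ → X N, IsMinimizingSeq a b c γ α β w →
      ∃ k : ℕ → ℕ, StrictMono k ∧ ∃ Φ : X N,
        Tendsto (fun j => normX (w (k j) - Φ)) atTop (𝓝 0)) ∧
    -- there is a minimizer
    (minimizers N a b c γ α β).Nonempty ∧
    -- every minimizing sequence converges to the set of minimizers
    (∀ w : ℕ → X N, IsMinimizingSeq a b c γ α β w →
      Tendsto (fun n => ⨅ Φ : minimizers N a b c γ α β, normX (w n - Φ.1)) atTop (𝓝 0)) := by
  obtain ⟨hb, hρ, hσ, h1, h2⟩ := exists_mass_coefficients habc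
  set ρ := (b - c) / (b ^ 2 - a * c) with hρd
  set σ := (b - a) / (b ^ 2 - a * c) with hσd
  have hN0 : (0 : ℝ) < N := by exact_mod_cast (by omega : 0 < N)
  -- The prescribed masses are ρ and σ times the same m = 2(N√ω - γ).
  obtain rfl : α = ρ * (2 * (N * √ω - γ)) := by rw [hα, massA, hρd]; ring
  obtain rfl : β = σ * (2 * (N * √ω - γ)) := by rw [hβ, massB, hσd]; ring
  have hm : 0 < 2 * (N * √ω - γ) := by
    have h3 : γ / N < √ω := Real.lt_sqrt_of_sq_lt (by rwa [div_pow])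
    rw [div_lt_iff₀' hN0] at h3
    linarith
  -- The upper bound on N√ω - γ is exactly the small-mass condition of the scalar problem.
  have hmγ : N * (2 * (N * √ω - γ)) ≤ 4 * γ := by
    rw [le_div_iff₀' hN0] at hωγ
    linarith
  refine ⟨bddBelow_energy hb hγ.le hρ hσ h1 h2, fun w hw => ?_,
    minimizers_nonempty hb hγ hρ hσ h1 h2 hm hmγ,
    fun w hw => hw.tendsto_iInf_normX hb hγ hρ hσ h1 h2 hm hmγ⟩
  obtain ⟨k, hk, Φ, -, hΦ⟩ := hw.exists_subseq_tendsto hb hγ hρ hσ h1 h2 hm hmγ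
  exact ⟨k, hk, Φ, hΦ⟩
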